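/- **Setting.** Let $\mathbb{R}^\infty=\bigcup_k\mathbb{R}^k$, $\mathbb{Q}^\infty=\bigcup_k\mathbb{Q}^k$, $\mathbb{Z}^\infty=\bigcup_k\mathbb{Z}^k$, and let $Q$ be an inner product on $\mathbb{R}^\infty$ with $Q(\mathbb{Z}^\infty,\mathbb{Z}^\infty)\subset\mathbb{Q}$. A *lattice cone* is a pair $(C,\Lambda_C)$ where $C\subset\mathbb{R}^\infty$ is a cone generated over $\mathbb{R}_{\ge 0}$ by finitely many vectors of $\mathbb{Q}^\infty$ which is strongly convex (it contains no line), and $\Lambda_C\subset\mathbb{Q}^\infty$ is a lattice in the linear span of $C$. Its dimension is that of the span of $C$. Let $\mathcal{C}$ be the set of lattice cones and $\mathbb{Q}\mathcal{C}$ the $\mathbb{Q}$-vector space with basis $\mathcal{C}$. * Write $(C,\Lambda_C)\perp^Q(D,\Lambda_D)$ if $Q(u,v)=0$ for all $u\in\Lambda_C$, $v\in\Lambda_D$. For $x,y\in\mathbb{Q}\mathcal{C}$ write $x\perp^Q y$ if every basis element appearing in $x$ is orthogonal to every basis element appearing in $y$. * The product is $(C,\Lambda_C)\cdot(D,\Lambda_D)=(C+D,\Lambda_C+\Lambda_D)$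 on orthogonal pairs, extended linearly to pairs $x\perp^Q y$. The unit is $1=(\{0\},\{0\})$. * The coproduct is the linear map with $\Delta(C,\Lambda_C)=\sum_{F<C}t((C,\Lambda_C),(F,\Lambda_F))\otimes(F,\Lambda_F)$, the sum being over all faces $F$ of $C$ ($C$ included), where $\Lambda_F=\Lambda_C\cap\mathrm{span}(F)$ and $t((C,\Lambda_C),(F,\Lambda_F))$ is the image of $(C,\Lambda_C)$ under the $Q$-orthogonal projection onto $\mathrm{span}(F)^{\perp}$. * The counit $\varepsilon$ is the linear form with $\varepsilon(\{0\},\{0\})=1$ and $\varepsilon(C,\Lambda_C)=0$ for every other lattice cone. * $\mathbb{Q}\mathcal{C}_n$ is the span of the lattice cones of dimension $n$. **Terminology.** Let $A$ be a vector space over a field $K$ with a symmetric relation $\top$. For $U\subseteq A$ put $U^\top=\{x\in A: u\top x\ \forall u\in U\}$. For $X,Y\subseteq A$ let $X\otimes_\top Y\subseteq A\otimes A$ be the span of all $x\otimes y$ with $x\in X$, $y\in Y$, $x\top y$. * $(A,\top)$ is a *locality vector space* if every $U^\top$ is a linear subspace. * A locality vector space is a *locality algebra* if it has a product $m$ defined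 on the pairs $x\top y$ and a unit $1$ with the following properties: $m$ is bilinear wherever the terms are defined; $x,y\in U^\top$ and $x\top y$ imply $xy\in U^\top$, for all $U\subseteq A$; $(xy)z=x(yz)$ for pairwise related $x,y,z$; $\{1\}^\top=A$; and $1x=x1=x$. A *homomorphism* of locality algebras is a linear map $f$ with $f(1)=1$ such that $x\top y$ implies $f(x)\top f(y)$ and $f(xy)=f(x)f(y)$. * A locality vector space is a *locality coalgebra* if it has a coassociative coproduct $\Delta$ with a two-sided counit $\varepsilon$ such that $\Delta(U^\top)\subseteq U^\top\otimes_\top U^\top$ for all $U\subseteq A$. * On $A\otimes_\top A$, call $x,y$ related if they can be written $x=\sum_i a_i\otimes b_i$, $y=\sum_j c_j\otimes d_j$ with $a_i,b_i,c_j,d_j$ pairwise related for all $i,j$. The product of such $x,y$ is $\sum_{i,j}a_ic_j\otimes b_id_j$. The unit is $1\otimes 1$. * A *locality bialgebra* is a locality algebra and locality coalgebra such that this product is a well-defined locality algebra structure on $A\otimes_\top A$, and $\Delta:A\to A\otimes_\top A$ and $\varepsilon:A\to K$ are homomorphisms of locality algebras (all pairs in $K$ being related). * It is *connected* with respect to a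 grading $A=\bigoplus_{n\ge0}A_n$ if $A_m\cdot A_n\subseteq A_{m+n}$ (on related pairs), $\Delta(A_n\cap U^\top)\subseteq\bigoplus_{p+q=n}(A_p\cap U^\top)\otimes_\top(A_q\cap U^\top)$ for all $U\subseteq A$ and $n\geq 0$, and $\bigoplus_{n\ge1}A_n=\ker\varepsilon$. **Proposition.** $(\mathbb{Q}\mathcal{C},\perp^Q,\cdot,1,\Delta,\varepsilon)$ is a locality bialgebra, connected with respect to the grading $\mathbb{Q}\mathcal{C}=\bigoplus_{n\ge0}\mathbb{Q}\mathcal{C}_n$ by dimension. In particular, $\Delta\big((C,\Lambda_C)\cdot(D,\Lambda_D)\big)=\Delta(C,\Lambda_C)\cdot\Delta(D,\Lambda_D)$ whenever $(C,\Lambda_C)\perp^Q(D,\Lambda_D)$. -/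

import Mathlib

open scoped TensorProduct

/-! ## Locality structures -/

/-- The polar subset `U^⊤` of a subset `U` of a set with a relation `⊤`. -/
def polar {A : Type*} (rel : A → A → Prop) (U : Set A) : Set A :=
  {x | ∀ u ∈ U, rel u x}

/-- A locality vector space: a vector space with a symmetric relation all of whose polar subsets
are linear subspaces. -/
structure IsLocalityVectorSpace (K : Type*) [Field K] {A : Type*} [AddCommGroup A] [Module K A]
    (rel : A → A → Prop) : Prop where
  symm : ∀ x y, rel x y → rel y x
  polar_subspace : ∀ U : Set A, ∃ S : Submodule K A, (S : Set A) = polar rel U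

/-- A (unital) locality algebra. The product `mul x y h` is a partial operation, defined only for
pairs `(x, y)` with `h : rel x y`. -/
structure IsLocalityAlgebra (K : Type*) [Field K] {A : Type*} [AddCommGroup A] [Module K A]
    (rel : A → A → Prop) (mul : (x y : A) → rel x y → A) (one : A) : Prop extends
    IsLocalityVectorSpace K rel where
  add_mul : ∀ x x' y (h : rel x y) (h' : rel x' y) (h'' : rel (x + x') y),
    mul (x + x') y h'' = mul x y h + mul x' y h'
  mul_add : ∀ x y y' (h : rel x y) (h' : rel x y') (h'' : rel x (y + y')),
    mul x (y + y') h'' = mul x y h + mul x y' h'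
  smul_mul : ∀ (k : K) x y (h : rel x y) (h' : rel (k • x) y), mul (k • x) y h' = k • mul x y h
  mul_smul : ∀ (k : K) x y (h : rel x y) (h' : rel x (k • y)), mul x (k • y) h' = k • mul x y h
  mul_mem_polar : ∀ (U : Set A) x y (h : rel x y),
    x ∈ polar rel U → y ∈ polar rel U → mul x y h ∈ polar rel U
  mul_assoc : ∀ x y z (hxy : rel x y) (hyz : rel y z), rel x z →
    ∀ (h : rel (mul x y hxy) z) (h' : rel x (mul y z hyz)),
      mul (mul x y hxy) z h = mul x (mul y z hyz) h'
  polar_one : polar rel {one} = Set.univ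
  mul_one : ∀ x (h : rel x one), mul x one h = x
  one_mul : ∀ x (h : rel one x), mul one x h = x

/-- Homomorphisms of (unital) locality algebras. -/
structure IsLocalityAlgebraHom {K : Type*} [Field K] {A B : Type*} [AddCommGroup A] [Module K A]
    [AddCommGroup B] [Module K B]
    (relA : A → A → Prop) (mulA : (x y : A) → relA x y → A) (oneA : A)
    (relB : B → B → Prop) (mulB : (x y : B) → relB x y → B) (oneB : B)
    (f : A →ₗ[K] B) : Prop where
  map_rel : ∀ x y, relA x y → relB (f x) (f y)
  map_mul : ∀ x y (h : relA x y) (h' : relB (f x) (f y)), f (mulA x y h) = mulB (f x) (f y) h'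
  map_one : f oneA = oneB

/-- For subsets `X`, `Y` of `A`, the locality tensor product `X ⊗_⊤ Y`: the span in `A ⊗ A` of all
`x ⊗ y` with `x ∈ X`, `y ∈ Y` and `x ⊤ y`. -/
def localityTensor (K : Type*) [Field K] {A : Type*} [AddCommGroup A] [Module K A]
    (rel : A → A → Prop) (X Y : Set A) : Submodule K (A ⊗[K] A) :=
  Submodule.span K {t | ∃ x ∈ X, ∃ y ∈ Y, rel x y ∧ t = x ⊗ₜ[K] y}

/-- The locality tensor square `A ⊗_⊤ A`. -/
abbrev localityTensorSquare (K : Type*) [Field K] {A : Type*} [AddCommGroup A] [Module K A]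
    (rel : A → A → Prop) : Submodule K (A ⊗[K] A) :=
  localityTensor K rel Set.univ Set.univ

/-- A (counital) locality coalgebra. -/
structure IsLocalityCoalgebra (K : Type*) [Field K] {A : Type*} [AddCommGroup A] [Module K A]
    (rel : A → A → Prop) (Δ : A →ₗ[K] A ⊗[K] A) (ε : A →ₗ[K] K) : Prop extends
    IsLocalityVectorSpace K rel where
  comul_mem : ∀ (U : Set A), ∀ x ∈ polar rel U,
    Δ x ∈ localityTensor K rel (polar rel U) (polar rel U)
  coassoc : TensorProduct.assoc K A A A ∘ₗ Δ.rTensor A ∘ₗ Δ = Δ.lTensor A ∘ₗ Δ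
  rTensor_counit : ∀ x, TensorProduct.lid K A (ε.rTensor A (Δ x)) = x
  lTensor_counit : ∀ x, TensorProduct.rid K A (ε.lTensor A (Δ x)) = x

/-- A pair of presentations `x = ∑ aᵢ ⊗ bᵢ`, `y = ∑ cⱼ ⊗ dⱼ` such that every quadruple
`(aᵢ, bᵢ, cⱼ, dⱼ)` consists of pairwise `⊤`-related elements. -/
structure IndependentPresentation (K : Type*) [Field K] {A : Type*} [AddCommGroup A] [Module K A]
    (rel : A → A → Prop) (x y : A ⊗[K] A) where
  m : ℕ
  n : ℕ
  a : Fin m → A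
  b : Fin m → A
  c : Fin n → A
  d : Fin n → A
  rel_ab : ∀ i, rel (a i) (b i)
  rel_cd : ∀ j, rel (c j) (d j)
  rel_ac : ∀ i j, rel (a i) (c j)
  rel_ad : ∀ i j, rel (a i) (d j)
  rel_bc : ∀ i j, rel (b i) (c j)
  rel_bd : ∀ i j, rel (b i) (d j)
  left_eq : x = ∑ i, a i ⊗ₜ[K] b i
  right_eq : y = ∑ j, c j ⊗ₜ[K] d j

/-- The product `∑ aᵢcⱼ ⊗ bᵢdⱼ` computed from a pair of presentations. -/
def IndependentPresentation.prod {K : Type*} [Field K] {A : Type*} [AddCommGroup A] [Module K A]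
    {rel : A → A → Prop} (mul : (x y : A) → rel x y → A) {x y : A ⊗[K] A}
    (P : IndependentPresentation K rel x y) : A ⊗[K] A :=
  ∑ i, ∑ j, mul (P.a i) (P.c j) (P.rel_ac i j) ⊗ₜ[K] mul (P.b i) (P.d j) (P.rel_bd i j)

/-- The locality relation on `A ⊗_⊤ A` induced by the one on `A`. -/
def tensorRel (K : Type*) [Field K] {A : Type*} [AddCommGroup A] [Module K A]
    (rel : A → A → Prop) (x y : localityTensorSquare K rel) : Prop :=
  Nonempty (IndependentPresentation K rel (x : A ⊗[K] A) (y : A ⊗[K] A))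

/-- `tmul` is the factorwise product `(a ⊗ b)(c ⊗ d) = ac ⊗ bd` on `A ⊗_⊤ A`: its value on every
related pair is the one computed from any presentation (so it is unique if it exists). -/
def IsTensorSquareMul (K : Type*) [Field K] {A : Type*} [AddCommGroup A] [Module K A]
    (rel : A → A → Prop) (mul : (x y : A) → rel x y → A)
    (tmul : (x y : localityTensorSquare K rel) → tensorRel K rel x y →
      localityTensorSquare K rel) : Prop :=
  ∀ x y (h : tensorRel K rel x y)
    (P : IndependentPresentation K rel (x : A ⊗[K] A) (y : A ⊗[K] A)),
    (tmul x y h : A ⊗[K] A) = P.prod mul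

/-- A locality bialgebra: a locality algebra and locality coalgebra such that `Δ : A → A ⊗_⊤ A`
and `ε : A → K` are locality algebra homomorphisms. Here `A ⊗_⊤ A` is the locality algebra with
the induced relation, the factorwise product and the unit `1 ⊗ 1`, and `K` is the locality algebra
in which any two elements are related. -/
structure IsLocalityBialgebra (K : Type*) [Field K] {A : Type*} [AddCommGroup A] [Module K A]
    (rel : A → A → Prop) (mul : (x y : A) → rel x y → A) (one : A)
    (Δ : A →ₗ[K] A ⊗[K] A) (ε : A →ₗ[K] K) : Prop where
  algebra : IsLocalityAlgebra K rel mul one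
  coalgebra : IsLocalityCoalgebra K rel Δ ε
  comul_hom : ∃ (tmul : (x y : localityTensorSquare K rel) → tensorRel K rel x y →
      localityTensorSquare K rel) (tone : localityTensorSquare K rel)
      (hΔ : ∀ x, Δ x ∈ localityTensorSquare K rel),
    IsTensorSquareMul K rel mul tmul ∧ (tone : A ⊗[K] A) = one ⊗ₜ[K] one ∧
    IsLocalityAlgebra K (tensorRel K rel) tmul tone ∧
    IsLocalityAlgebraHom rel mul one (tensorRel K rel) tmul tone
      (Δ.codRestrict (localityTensorSquare K rel) hΔ)
  counit_hom : IsLocalityAlgebraHom rel mul one (fun _ _ : K => True) (fun x y _ => x * y) 1 ε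

/-- A locality bialgebra that is connected with respect to the grading `𝒢`. -/
structure IsConnectedLocalityBialgebra (K : Type*) [Field K] {A : Type*} [AddCommGroup A]
    [Module K A] (rel : A → A → Prop) (mul : (x y : A) → rel x y → A) (one : A)
    (Δ : A →ₗ[K] A ⊗[K] A) (ε : A →ₗ[K] K) (𝒢 : ℕ → Submodule K A) : Prop extends
    IsLocalityBialgebra K rel mul one Δ ε where
  isInternal : DirectSum.IsInternal 𝒢
  mul_mem_graded : ∀ m n x y (h : rel x y), x ∈ 𝒢 m → y ∈ 𝒢 n → mul x y h ∈ 𝒢 (m + n)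
  comul_mem_graded : ∀ (U : Set A) n x, x ∈ 𝒢 n → x ∈ polar rel U →
    Δ x ∈ ⨆ p ∈ Finset.HasAntidiagonal.antidiagonal n,
      localityTensor K rel ((𝒢 p.1 : Set A) ∩ polar rel U) ((𝒢 p.2 : Set A) ∩ polar rel U)
  ker_counit : ⨆ n : ℕ, 𝒢 (n + 1) = LinearMap.ker ε

/-! ## Lattice cones -/

/-- The space `ℝ^∞ = ⋃ ℝ^k`. -/
abbrev RInf : Type := ℕ →₀ ℝ

/-- Vectors of `ℚ^∞ = ⋃ ℚ^k`. -/
def IsRationalVec (v : RInf) : Prop := ∀ i, ∃ q : ℚ, v i = (q : ℝ)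

/-- An inner product on `ℝ^∞` with rational values on `ℤ^∞`; this is the same thing as a
compatible family of such inner products on the spaces `ℝ^k`. -/
structure RationalInnerProduct where
  form : LinearMap.BilinForm ℝ RInf
  symm : ∀ u v, form u v = form v u
  pos : ∀ u, u ≠ 0 → 0 < form u u
  rational : ∀ u v : ℕ →₀ ℤ, ∃ q : ℚ,
    form (u.mapRange (fun z : ℤ => (z : ℝ)) Int.cast_zero)
      (v.mapRange (fun z : ℤ => (z : ℝ)) Int.cast_zero) = (q : ℝ)

/-- A (strongly convex) lattice cone in `ℝ^∞`: a strongly convex polyhedral cone generated by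
finitely many rational vectors, together with a lattice of rational vectors in its linear span,
i.e. a finitely generated group of rational vectors in the span which spans it over `ℝ`. -/
@[ext]
structure LatticeCone where
  cone : PointedCone ℝ RInf
  lattice : Submodule ℤ RInf
  polyhedral : ∃ s : Finset RInf, (∀ v ∈ s, IsRationalVec v) ∧
    cone = PointedCone.hull ℝ (s : Set RInf)
  salient : (cone : ConvexCone ℝ RInf).Salient
  lattice_fg : lattice.FG
  lattice_rational : ∀ v ∈ lattice, IsRationalVec v
  span_lattice : Submodule.span ℝ (lattice : Set RInf) = Submodule.span ℝ (cone : Set RInf)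

namespace RatRetract

theorem exists_phi : ∃ φ : ℝ →ₗ[ℚ] ℚ, ∀ q : ℚ, φ (q : ℝ) = q := by
  obtain ⟨g, hg⟩ := LinearMap.exists_leftInverse_of_injective (Algebra.linearMap ℚ ℝ)
    (LinearMap.ker_eq_bot.2 (algebraMap ℚ ℝ).injective)
  exact ⟨g, fun q => by simpa using LinearMap.congr_fun hg q⟩

/-- There is a `ℚ`-linear retraction of `ℝ^∞` onto `ℚ^∞`, given by a `ℚ`-linear form on `ℝ`. -/
theorem exists_retract : ∃ (φ : ℝ →ₗ[ℚ] ℚ) (ρ : RInf →ₗ[ℚ] RInf),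
    (∀ v i, ρ v i = (φ (v i) : ℝ)) ∧ (∀ q : ℚ, φ (q : ℝ) = q) ∧
    (∀ v, IsRationalVec (ρ v)) ∧ (∀ v, IsRationalVec v → ρ v = v) ∧
    (∀ (r : ℝ) v, IsRationalVec v → ρ (r • v) = (φ r : ℝ) • v) := by
  obtain ⟨φ, hφ⟩ := exists_phi
  refine ⟨φ, Finsupp.mapRange.linearMap ((Algebra.linearMap ℚ ℝ) ∘ₗ φ), ?_, hφ, ?_, ?_, ?_⟩
  · intro v i; simp
  · intro v i; exact ⟨φ (v i), by simp⟩
  · intro v hv; ext i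
    obtain ⟨q, hq⟩ := hv i
    simp [hq, hφ]
  · intro r v hv; ext i
    obtain ⟨q, hq⟩ := hv i
    have : φ (r * (q : ℝ)) = φ r * q := by
      have := φ.map_smul q r
      rw [Rat.smul_def, smul_eq_mul] at this
      rw [mul_comm, this, mul_comm]
    simp [hq, this]

end RatRetract

theorem IsRationalVec.zero : IsRationalVec 0 := fun _ => ⟨0, by simp⟩

theorem IsRationalVec.add {u v : RInf} (hu : IsRationalVec u) (hv : IsRationalVec v) :
    IsRationalVec (u + v) := fun i => by
  obtain ⟨p, hp⟩ := hu i
  obtain ⟨q, hq⟩ := hv i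
  exact ⟨p + q, by simp [hp, hq]⟩

theorem retract_zsmul_mem {φ : ℝ →ₗ[ℚ] ℚ} {ρ : RInf →ₗ[ℚ] RInf}
    (hsm : ∀ (r : ℝ) v, IsRationalVec v → ρ (r • v) = (φ r : ℝ) • v)
    {L : Submodule ℤ RInf} (hL : ∀ v ∈ L, IsRationalVec v) {x : RInf}
    (hx : x ∈ Submodule.span ℝ (L : Set RInf)) :
    ∀ r : ℝ, ∃ n : ℤ, n ≠ 0 ∧ n • ρ (r • x) ∈ L := by
  induction hx using Submodule.span_induction with
  | mem x hx =>
    intro r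
    refine ⟨(φ r).den, by simp, ?_⟩
    rw [hsm r x (hL x hx)]
    have : ((φ r).den : ℤ) • ((φ r : ℝ) • x) = (φ r).num • x := by
      rw [← Int.cast_smul_eq_zsmul ℝ, ← Int.cast_smul_eq_zsmul ℝ, smul_smul]
      congr 1
      have := Rat.den_mul_eq_num (φ r)
      exact_mod_cast this
    rw [this]
    exact L.smul_mem _ hx
  | zero => intro r; exact ⟨1, by simp, by simp⟩
  | add x y hx hy ihx ihy =>
    intro r
    obtain ⟨m, hm, hm'⟩ := ihx r
    obtain ⟨n, hn, hn'⟩ := ihy r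
    refine ⟨m * n, mul_ne_zero hm hn, ?_⟩
    rw [smul_add r x y, map_add, smul_add]
    refine L.add_mem ?_ ?_
    · rw [mul_comm, mul_smul]; exact L.smul_mem _ hm'
    · rw [mul_smul]; exact L.smul_mem _ hn'
  | smul a x hx ih =>
    intro r
    rw [smul_smul]
    exact ih (r * a)

/-- A rational vector in the real span of a group of rational vectors has a non-zero integer
multiple in that group. -/
theorem exists_zsmul_mem {L : Submodule ℤ RInf} (hL : ∀ v ∈ L, IsRationalVec v) {g : RInf}
    (hg : IsRationalVec g) (hgL : g ∈ Submodule.span ℝ (L : Set RInf)) :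
    ∃ n : ℤ, n ≠ 0 ∧ n • g ∈ L := by
  obtain ⟨φ, ρ, -, hφ, -, hid, hsm⟩ := RatRetract.exists_retract
  obtain ⟨n, hn, h⟩ := retract_zsmul_mem hsm hL hgL 1
  refine ⟨n, hn, ?_⟩
  rwa [one_smul, hid g hg] at h

theorem span_hull_eq (s : Set RInf) :
    Submodule.span ℝ (PointedCone.hull ℝ s : Set RInf) = Submodule.span ℝ s := by
  apply le_antisymm
  · rw [Submodule.span_le]
    exact fun x hx => PointedCone.hull_le_span ℝ s hx
  · exact Submodule.span_mono PointedCone.subset_hull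

/-- A face of a finitely generated cone is generated by the generators that it contains. -/
theorem face_eq_hull {s : Set RInf} {F C : PointedCone ℝ RInf}
    (hC : C = PointedCone.hull ℝ s) (hF : F.IsFaceOf C) :
    F = PointedCone.hull ℝ (s ∩ F) := by
  subst hC
  apply le_antisymm
  · have key : ∀ x ∈ PointedCone.hull ℝ s, x ∈ F → x ∈ PointedCone.hull ℝ (s ∩ F) := by
      intro x hx
      induction hx using Submodule.span_induction with
      | mem x hx => exact fun h => Submodule.subset_span ⟨hx, h⟩
      | zero => exact fun _ => zero_mem _
      | add x y hx hy ihx ihy =>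
        intro h
        have := (hF.add_mem_iff_mem hx hy).1 h
        exact add_mem (ihx this.1) (ihy this.2)
      | smul a x hx ih =>
        intro h
        rcases eq_or_ne a 0 with rfl | ha
        · simp
        · have hx' : x ∈ F := by
            have := Submodule.smul_mem F a⁻¹ h
            rwa [smul_smul, inv_mul_cancel₀ ha, one_smul] at this
          exact Submodule.smul_mem _ a (ih hx')
    exact fun x hx => key x (hF.le hx) hx
  · exact Submodule.span_le.2 fun x hx => hx.2

namespace LatticeCone

/-- The linear span of a lattice cone. -/
noncomputable def lin (C : LatticeCone) : Submodule ℝ RInf :=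
  Submodule.span ℝ (C.cone : Set RInf)

/-- The dimension of a lattice cone. -/
noncomputable def dim (C : LatticeCone) : ℕ := Module.finrank ℝ C.lin

/-- The lattice cone `({0}, {0})`. -/
noncomputable def zero : LatticeCone where
  cone := ⊥
  lattice := ⊥
  polyhedral := ⟨∅, by simp, by simp⟩
  salient := by
    intro x hx hx0
    exact absurd (by simpa using hx) hx0
  lattice_fg := Submodule.fg_bot
  lattice_rational := by
    intro v hv
    rw [(Submodule.mem_bot ℤ).1 hv]
    exact IsRationalVec.zero
  span_lattice := by simp

/-- The type of faces of (the cone underlying) a lattice cone, the cone itself included. -/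
def Face (C : LatticeCone) : Type := {F : PointedCone ℝ RInf // F.IsFaceOf C.cone}

instance (C : LatticeCone) : Finite C.Face := by
  obtain ⟨s, -, hs⟩ := C.polyhedral
  have : Function.Injective
      (fun F : C.Face => (⟨(s : Set RInf) ∩ F.1, Set.inter_subset_left⟩ :
        {t : Set RInf // t ⊆ (s : Set RInf)})) := by
    intro F G h
    have h' : (s : Set RInf) ∩ F.1 = (s : Set RInf) ∩ G.1 := congrArg Subtype.val h
    apply Subtype.ext
    rw [face_eq_hull hs F.2, face_eq_hull hs G.2, h']
  have : Finite {t : Set RInf // t ⊆ (s : Set RInf)} :=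
    (Set.Finite.finite_subsets s.finite_toSet).to_subtype
  exact Finite.of_injective _ ‹_›

noncomputable instance (C : LatticeCone) : Fintype C.Face := Fintype.ofFinite _

/-- A face `F` of `(C, Λ_C)` as a lattice cone, with the lattice `Λ_F = Λ_C ∩ span F`. -/
noncomputable def face (C : LatticeCone) (F : C.Face) : LatticeCone where
  cone := F.1
  lattice := C.lattice ⊓ (Submodule.span ℝ (F.1 : Set RInf)).restrictScalars ℤ
  polyhedral := by
    classical
    obtain ⟨s, hs, hC⟩ := C.polyhedral
    refine ⟨s.filter (fun v => v ∈ F.1), fun v hv => hs v (Finset.mem_filter.1 hv).1, ?_⟩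
    rw [Finset.coe_filter]
    exact face_eq_hull hC F.2
  salient := C.salient.anti F.2.le
  lattice_fg := by
    have : IsNoetherian ℤ C.lattice := isNoetherian_of_fg_of_noetherian _ C.lattice_fg
    exact Submodule.FG.of_le C.lattice_fg inf_le_left
  lattice_rational := fun v hv => C.lattice_rational v hv.1
  span_lattice := by
    obtain ⟨s, hs, hC⟩ := C.polyhedral
    apply le_antisymm
    · exact Submodule.span_le.2 fun v hv => hv.2
    · conv_lhs => rw [face_eq_hull hC F.2, span_hull_eq]
      rw [Submodule.span_le]
      rintro g ⟨hgs, hgF⟩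
      have hgC : g ∈ Submodule.span ℝ (C.lattice : Set RInf) := by
        rw [C.span_lattice]
        exact Submodule.subset_span (F.2.le hgF)
      obtain ⟨n, hn, hng⟩ := exists_zsmul_mem C.lattice_rational (hs g hgs) hgC
      have hmem : n • g ∈ Submodule.span ℝ
          ((C.lattice ⊓ (Submodule.span ℝ (F.1 : Set RInf)).restrictScalars ℤ :
            Submodule ℤ RInf) : Set RInf) :=
        Submodule.subset_span ⟨hng,
          Submodule.smul_mem ((Submodule.span ℝ (F.1 : Set RInf)).restrictScalars ℤ) n
            (Submodule.subset_span hgF)⟩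
      have := Submodule.smul_mem _ ((n : ℝ)⁻¹) hmem
      rwa [← Int.cast_smul_eq_zsmul ℝ, smul_smul,
        inv_mul_cancel₀ (Int.cast_ne_zero.2 hn), one_smul] at this

theorem lin_finiteDimensional (C : LatticeCone) : FiniteDimensional ℝ C.lin := by
  obtain ⟨s, -, hC⟩ := C.polyhedral
  rw [lin, hC, span_hull_eq]
  infer_instance

/-- The linear span of a lattice cone is spanned by rational vectors. -/
theorem lin_eq_span_lattice (C : LatticeCone) :
    C.lin = Submodule.span ℝ (C.lattice : Set RInf) := C.span_lattice.symm

end LatticeCone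

theorem isCompl_orthogonal_of_pos {V : Type*} [AddCommGroup V] [Module ℝ V]
    (B : LinearMap.BilinForm ℝ V) (hsymm : ∀ u v, B u v = B v u) (hB : ∀ u, u ≠ 0 → 0 < B u u)
    (W : Submodule ℝ V) [FiniteDimensional ℝ W] : IsCompl (B.orthogonal W) W := by
  have hpos : ∀ w : W, w ≠ 0 → 0 < B w w := fun w hw => hB w (by simpa using hw)
  let T : W →ₗ[ℝ] Module.Dual ℝ W := B.domRestrict₁₂ W W
  have hinj : Function.Injective T := by
    rw [injective_iff_map_eq_zero]
    intro w hw
    by_contra h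
    have h1 := hpos w h
    have h2 : T w w = 0 := by rw [hw]; rfl
    exact h1.ne' h2
  have hsurj : Function.Surjective T := by
    rw [← LinearMap.range_eq_top]
    apply Submodule.eq_top_of_finrank_eq
    rw [LinearMap.finrank_range_of_inj hinj, Subspace.dual_finrank_eq]
  constructor
  · rw [Submodule.disjoint_def]
    intro x hx hxW
    by_contra h
    exact (hB x h).ne' (hx x hxW)
  · rw [codisjoint_iff, eq_top_iff]
    rintro x -
    obtain ⟨w, hw⟩ := hsurj ((B x).domRestrict W)
    refine Submodule.mem_sup.2 ⟨x - w, ?_, w, w.2, by simp⟩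
    intro v hv
    have := LinearMap.congr_fun hw ⟨v, hv⟩
    have h3 : B w v = B x v := this
    show B v (x - w) = 0
    rw [map_sub, hsymm v x, hsymm v w, h3, sub_self]

namespace RationalInnerProduct

/-- The orthogonal subspace of a subspace. -/
noncomputable def orth (Q : RationalInnerProduct) (W : Submodule ℝ RInf) : Submodule ℝ RInf :=
  Q.form.orthogonal W

theorem mem_orth (Q : RationalInnerProduct) {W : Submodule ℝ RInf} {x : RInf} :
    x ∈ Q.orth W ↔ ∀ w ∈ W, Q.form w x = 0 := Iff.rfl

theorem isCompl_orth (Q : RationalInnerProduct) (W : Submodule ℝ RInf) [FiniteDimensional ℝ W] :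
    IsCompl (Q.orth W) W :=
  isCompl_orthogonal_of_pos Q.form Q.symm Q.pos W

end RationalInnerProduct

namespace LatticeCone

/-- The `Q`-orthogonal projection of `ℝ^∞` onto the orthogonal subspace of the span of `F`. -/
noncomputable def proj (Q : RationalInnerProduct) (F : LatticeCone) : RInf →ₗ[ℝ] RInf :=
  haveI := F.lin_finiteDimensional
  (Q.orth F.lin).projection F.lin (Q.isCompl_orth F.lin)

theorem proj_mem (Q : RationalInnerProduct) (F : LatticeCone) (x : RInf) :
    F.proj Q x ∈ Q.orth F.lin := by
  have := F.lin_finiteDimensional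
  exact Submodule.projection_apply_mem (Q.isCompl_orth F.lin) x

theorem sub_proj_mem (Q : RationalInnerProduct) (F : LatticeCone) (x : RInf) :
    x - F.proj Q x ∈ F.lin := by
  have := F.lin_finiteDimensional
  exact Submodule.sub_projection_mem (Q.isCompl_orth F.lin) x

theorem proj_eq_of (Q : RationalInnerProduct) (F : LatticeCone) {x y : RInf}
    (hy : y ∈ Q.orth F.lin) (hxy : x - y ∈ F.lin) : F.proj Q x = y := by
  have := F.lin_finiteDimensional
  have h1 : F.proj Q x - y ∈ Q.orth F.lin := sub_mem (F.proj_mem Q x) hy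
  have h2 : F.proj Q x - y ∈ F.lin := by
    have := sub_mem hxy (F.sub_proj_mem Q x)
    rwa [show x - y - (x - F.proj Q x) = F.proj Q x - y by abel] at this
  exact sub_eq_zero.1 (Submodule.disjoint_def.1 (Q.isCompl_orth F.lin).disjoint _ h1 h2)

end LatticeCone

theorem RationalInnerProduct.rational_basis (Q : RationalInnerProduct) (i j : ℕ) :
    ∃ q : ℚ, Q.form (Finsupp.single i 1) (Finsupp.single j 1) = (q : ℝ) := by
  simpa using Q.rational (Finsupp.single i 1) (Finsupp.single j 1)

theorem RationalInnerProduct.form_retract (Q : RationalInnerProduct) {φ : ℝ →ₗ[ℚ] ℚ}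
    {ρ : RInf →ₗ[ℚ] RInf} (hρ : ∀ v i, ρ v i = (φ (v i) : ℝ)) {w : RInf}
    (hw : IsRationalVec w) (y : RInf) : Q.form w (ρ y) = (φ (Q.form w y) : ℝ) := by
  have hφ : ∀ (q : ℚ) (r : ℝ), φ ((q : ℝ) * r) = q * φ r := by
    intro q r
    have := φ.map_smul q r
    rwa [Rat.smul_def, smul_eq_mul] at this
  have hb : ∀ j, ∃ q : ℚ, Q.form w (Finsupp.single j 1) = (q : ℝ) := by
    intro j
    choose c hc using hw
    choose e he using fun i => Q.rational_basis i j
    refine ⟨∑ i ∈ w.support, c i * e i, ?_⟩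
    conv_lhs => rw [← Finsupp.sum_single w, Finsupp.sum, map_sum, LinearMap.sum_apply]
    push_cast
    refine Finset.sum_congr rfl fun i _ => ?_
    rw [← he, ← hc, show (Finsupp.single i (w i) : RInf) = w i • Finsupp.single i 1 by simp]
    simp only [map_smul, LinearMap.smul_apply, smul_eq_mul]
  have hexp : ∀ (v : RInf) (t : Finset ℕ), v.support ⊆ t →
      Q.form w v = ∑ j ∈ t, Q.form w (Finsupp.single j 1) * v j := by
    intro v t ht
    conv_lhs => rw [← Finsupp.sum_single v, Finsupp.sum_of_support_subset v ht _ (by simp), map_sum]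
    refine Finset.sum_congr rfl fun j _ => ?_
    rw [show (Finsupp.single j (v j) : RInf) = v j • Finsupp.single j 1 by simp, map_smul,
      smul_eq_mul, mul_comm]
  classical
  rw [hexp (ρ y) (y.support ∪ (ρ y).support) Finset.subset_union_right,
    hexp y (y.support ∪ (ρ y).support) Finset.subset_union_left, map_sum]
  push_cast
  refine Finset.sum_congr rfl fun j _ => ?_
  obtain ⟨q, hq⟩ := hb j
  rw [hq, hφ, hρ]
  push_cast
  rfl

namespace LatticeCone

/-- Orthogonal projections along rational subspaces preserve rationality. -/
theorem proj_rational (Q : RationalInnerProduct) (F : LatticeCone) {x : RInf}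
    (hx : IsRationalVec x) : IsRationalVec (F.proj Q x) := by
  obtain ⟨φ, ρ, hρ, hφ, hrat, hid, hsm⟩ := RatRetract.exists_retract
  have hlin : ∀ v ∈ F.lin, ρ v ∈ F.lin := by
    intro v hv
    rw [F.lin_eq_span_lattice] at hv
    obtain ⟨n, hn, h⟩ := retract_zsmul_mem hsm F.lattice_rational hv 1
    rw [one_smul] at h
    have h' : n • ρ v ∈ F.lin := by
      rw [F.lin_eq_span_lattice]; exact Submodule.subset_span h
    have := F.lin.smul_mem ((n : ℝ)⁻¹) h'
    rwa [← Int.cast_smul_eq_zsmul ℝ, smul_smul,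
      inv_mul_cancel₀ (Int.cast_ne_zero.2 hn), one_smul] at this
  have key : F.proj Q x = ρ (F.proj Q x) := by
    apply F.proj_eq_of Q
    · have : F.lin ≤ LinearMap.ker (Q.form.flip (ρ (F.proj Q x))) := by
        rw [F.lin_eq_span_lattice, Submodule.span_le]
        intro w hw
        have h0 : Q.form w (F.proj Q x) = 0 := F.proj_mem Q x w (by
          rw [F.lin_eq_span_lattice]; exact Submodule.subset_span hw)
        have h1 := Q.form_retract hρ (F.lattice_rational w hw) (F.proj Q x)
        rw [h0, map_zero, Rat.cast_zero] at h1
        exact h1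
      exact fun w hw => this hw
    · have h := hlin _ (F.sub_proj_mem Q x)
      rwa [map_sub, hid x hx] at h
  rw [key]
  exact hrat _

/-- The transverse cone `t((C, Λ_C), (F, Λ_F))`: the orthogonal projection of `(C, Λ_C)` to the
orthogonal subspace of the span of the face `F`. -/
noncomputable def transverse (Q : RationalInnerProduct) (C : LatticeCone) (F : C.Face) :
    LatticeCone where
  cone := C.cone.map ((C.face F).proj Q)
  lattice := C.lattice.map (((C.face F).proj Q).restrictScalars ℤ)
  polyhedral := by
    classical
    obtain ⟨s, hs, hC⟩ := C.polyhedral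
    refine ⟨s.image ((C.face F).proj Q), ?_, ?_⟩
    · intro v hv
      obtain ⟨u, hu, rfl⟩ := Finset.mem_image.1 hv
      exact proj_rational Q _ (hs u hu)
    · rw [hC, Finset.coe_image]
      exact Submodule.map_span _ _
  salient := by
    rintro _ ⟨x, hx, rfl⟩ hne ⟨y, hy, hxy⟩
    apply hne
    have hxy' : (C.face F).proj Q y = -(C.face F).proj Q x := hxy
    have hz : x + y ∈ (C.face F).lin := by
      have := (C.face F).sub_proj_mem Q (x + y)
      rwa [map_add, hxy', add_neg_cancel, sub_zero] at this
    have hdiff : ∃ f ∈ F.1, x + y + f ∈ F.1 := by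
      have : ∀ z ∈ Submodule.span ℝ (F.1 : Set RInf), ∃ f ∈ F.1, z + f ∈ F.1 := by
        intro z hz
        induction hz using Submodule.span_induction with
        | mem z hz => exact ⟨0, zero_mem _, by simpa using hz⟩
        | zero => exact ⟨0, zero_mem _, by simp⟩
        | add u v _ _ hu hv =>
          obtain ⟨f, hf, hf'⟩ := hu
          obtain ⟨g, hg, hg'⟩ := hv
          exact ⟨f + g, add_mem hf hg, by
            rw [show u + v + (f + g) = (u + f) + (v + g) by abel]; exact add_mem hf' hg'⟩
        | smul a u _ hu =>
          obtain ⟨f, hf, hf'⟩ := hu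
          rcases le_total 0 a with ha | ha
          · exact ⟨a • f, F.1.smul_mem ha hf, by
              rw [← smul_add]; exact F.1.smul_mem ha hf'⟩
          · refine ⟨(-a) • (u + f), F.1.smul_mem (neg_nonneg.2 ha) hf', ?_⟩
            rw [show a • u + (-a) • (u + f) = (-a) • f by rw [smul_add, neg_smul a u]; abel]
            exact F.1.smul_mem (neg_nonneg.2 ha) hf
      exact this _ hz
    obtain ⟨f, hf, hsum⟩ := hdiff
    have hxF : x ∈ F.1 := by
      rw [add_assoc] at hsum
      exact F.2.mem_of_add_mem_left hx (add_mem hy (F.2.le hf)) hsum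
    exact (C.face F).proj_eq_of Q (zero_mem _) (by
      rw [sub_zero]; exact Submodule.subset_span hxF)
  lattice_fg := C.lattice_fg.map _
  lattice_rational := by
    rintro _ ⟨v, hv, rfl⟩
    exact proj_rational Q _ (C.lattice_rational v hv)
  span_lattice := by
    have h1 : ((C.lattice.map (((C.face F).proj Q).restrictScalars ℤ) : Submodule ℤ RInf) :
        Set RInf) = (C.face F).proj Q '' (C.lattice : Set RInf) := rfl
    rw [h1, PointedCone.coe_map, ← Submodule.map_span, ← Submodule.map_span, C.span_lattice]

/-- Orthogonality of lattice cones. -/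
def Orthogonal (Q : RationalInnerProduct) (C D : LatticeCone) : Prop :=
  ∀ u ∈ C.lattice, ∀ v ∈ D.lattice, Q.form u v = 0

theorem Orthogonal.lin {Q : RationalInnerProduct} {C D : LatticeCone} (h : Orthogonal Q C D)
    {x y : RInf} (hx : x ∈ C.lin) (hy : y ∈ D.lin) : Q.form x y = 0 := by
  rw [lin_eq_span_lattice] at hx hy
  induction hx using Submodule.span_induction with
  | mem x hx =>
    induction hy using Submodule.span_induction with
    | mem y hy => exact h x hx y hy
    | zero => simp
    | add y z _ _ hy hz => rw [map_add, hy, hz, add_zero]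
    | smul a y _ hy => rw [map_smul, hy, smul_zero]
  | zero => simp
  | add x z _ _ hx hz => rw [map_add, LinearMap.add_apply, hx, hz, add_zero]
  | smul a x _ hx => rw [map_smul, LinearMap.smul_apply, hx, smul_zero]

/-- The Minkowski product of orthogonal lattice cones: `(C + D, Λ_C + Λ_D)`. -/
noncomputable def mul (Q : RationalInnerProduct) (C D : LatticeCone) (h : Orthogonal Q C D) :
    LatticeCone where
  cone := C.cone ⊔ D.cone
  lattice := C.lattice ⊔ D.lattice
  polyhedral := by
    classical
    obtain ⟨s, hs, hC⟩ := C.polyhedral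
    obtain ⟨t, ht, hD⟩ := D.polyhedral
    refine ⟨s ∪ t, fun v hv => (Finset.mem_union.1 hv).elim (hs v) (ht v), ?_⟩
    rw [hC, hD, Finset.coe_union]
    exact (Submodule.span_union _ _).symm
  salient := by
    intro x hx hne hnx
    obtain ⟨c, hc, d, hd, rfl⟩ := Submodule.mem_sup.1 (show x ∈ C.cone ⊔ D.cone from hx)
    obtain ⟨c', hc', d', hd', hsum⟩ :=
      Submodule.mem_sup.1 (show -(c + d) ∈ C.cone ⊔ D.cone from hnx)
    have hcc : c + c' ∈ C.lin := Submodule.subset_span (add_mem hc hc')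
    have hdd : d + d' ∈ D.lin := Submodule.subset_span (add_mem hd hd')
    have htot : c + c' = -(d + d') := by
      have : c + c' + (d + d') = 0 := by
        rw [show c + c' + (d + d') = (c + d) + (c' + d') by abel, hsum, add_neg_cancel]
      exact eq_neg_of_add_eq_zero_left this
    have h0 : c + c' = 0 := by
      by_contra hne0
      have hp := Q.pos _ hne0
      have hz := h.lin hcc (neg_mem hdd)
      rw [← htot] at hz
      exact hp.ne' hz
    have h1 : d + d' = 0 := by rw [h0] at htot; exact neg_eq_zero.1 htot.symm
    have hc0 : c = 0 := by
      by_contra hcne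
      exact C.salient c hc hcne (by rw [neg_eq_of_add_eq_zero_right h0]; exact hc')
    have hd0 : d = 0 := by
      by_contra hdne
      exact D.salient d hd hdne (by rw [neg_eq_of_add_eq_zero_right h1]; exact hd')
    exact hne (by rw [hc0, hd0, add_zero])
  lattice_fg := C.lattice_fg.sup D.lattice_fg
  lattice_rational := by
    intro v hv
    obtain ⟨a, ha, b, hb, rfl⟩ := Submodule.mem_sup.1 hv
    exact (C.lattice_rational a ha).add (D.lattice_rational b hb)
  span_lattice := by
    apply le_antisymm
    · rw [Submodule.span_le]
      intro v hv
      obtain ⟨a, ha, b, hb, rfl⟩ := Submodule.mem_sup.1 hv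
      refine add_mem ?_ ?_
      · refine Submodule.span_mono (show (C.cone : Set RInf) ⊆ _ from
          (le_sup_left : C.cone ≤ C.cone ⊔ D.cone)) ?_
        rw [← C.span_lattice]; exact Submodule.subset_span ha
      · refine Submodule.span_mono (show (D.cone : Set RInf) ⊆ _ from
          (le_sup_right : D.cone ≤ C.cone ⊔ D.cone)) ?_
        rw [← D.span_lattice]; exact Submodule.subset_span hb
    · rw [Submodule.span_le]
      intro v hv
      obtain ⟨a, ha, b, hb, rfl⟩ := Submodule.mem_sup.1 (show v ∈ C.cone ⊔ D.cone from hv)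
      refine add_mem ?_ ?_
      · refine Submodule.span_mono (show (C.lattice : Set RInf) ⊆ _ from
          (le_sup_left : C.lattice ≤ C.lattice ⊔ D.lattice)) ?_
        rw [C.span_lattice]; exact Submodule.subset_span ha
      · refine Submodule.span_mono (show (D.lattice : Set RInf) ⊆ _ from
          (le_sup_right : D.lattice ≤ C.lattice ⊔ D.lattice)) ?_
        rw [D.span_lattice]; exact Submodule.subset_span hb

end LatticeCone

/-! ## The space of lattice cones -/

/-- The rational vector space `ℚ𝒞` with basis the set of lattice cones. -/
abbrev ConeSpace : Type := LatticeCone →₀ ℚ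

namespace ConeSpace

/-- The relation `⊥^Q` on `ℚ𝒞`, the linear extension of orthogonality: all basis elements
appearing in `x` are orthogonal to all basis elements appearing in `y`. -/
def rel (Q : RationalInnerProduct) (x y : ConeSpace) : Prop :=
  ∀ C ∈ x.support, ∀ D ∈ y.support, LatticeCone.Orthogonal Q C D

open Classical in
/-- The (partial) Minkowski product on `ℚ𝒞`, extended linearly from orthogonal pairs of lattice
cones. As `x` and `y` are related, the `else` branch is never used. -/
noncomputable def mul (Q : RationalInnerProduct) (x y : ConeSpace) (_ : rel Q x y) : ConeSpace :=
  x.sum fun C r => y.sum fun D s =>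
    if h : LatticeCone.Orthogonal Q C D then Finsupp.single (C.mul Q D h) (r * s) else 0

/-- The unit of `ℚ𝒞`: the lattice cone `({0}, {0})`. -/
noncomputable def one : ConeSpace := Finsupp.single LatticeCone.zero 1

/-- The coproduct `Δ(C, Λ_C) = ∑_{F < C} t((C, Λ_C), (F, Λ_F)) ⊗ (F, Λ_F)`. -/
noncomputable def comul (Q : RationalInnerProduct) : ConeSpace →ₗ[ℚ] ConeSpace ⊗[ℚ] ConeSpace :=
  Finsupp.linearCombination ℚ fun C : LatticeCone =>
    ∑ F : C.Face, (Finsupp.single (C.transverse Q F) (1 : ℚ) : ConeSpace) ⊗ₜ[ℚ]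
      (Finsupp.single (C.face F) (1 : ℚ) : ConeSpace)

open Classical in
/-- The counit: `1` on `({0}, {0})` and `0` on every other lattice cone. -/
noncomputable def counit : ConeSpace →ₗ[ℚ] ℚ :=
  Finsupp.linearCombination ℚ fun C : LatticeCone => if C = LatticeCone.zero then (1 : ℚ) else 0

/-- The grading of `ℚ𝒞` by dimension. -/
def grading (n : ℕ) : Submodule ℚ ConeSpace := Finsupp.supported ℚ ℚ {C | C.dim = n}

end ConeSpace

/-! The algebraic identities reduce to statements about single lattice cones, and those rest on two
facts of convex geometry.

Coassociativity is a matching of flags. Let `π` be the projection off the span of a face `G`. The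
faces of `t(C, G)` are the cones `π(F)` for the faces `F ⊇ G` of `C` (`faceTransverseEquiv`). As
lattice cones these faces are `t(F, G)` (`face_transverse`), and the transverse cone of `t(C, G)`
along one of them is `t(C, F)` (`transverse_transverse`). Hence both iterated coproducts of `C` are
the sum of `t(C, F) ⊗ t(F, G) ⊗ G` over all flags `G ⊆ F`.

Multiplicativity comes from orthogonality. Since `Q` is positive definite, orthogonal cones `C`, `D`
have spans meeting only in `0`, so vectors of `C + D` decompose uniquely. The faces of `C + D` are
therefore the `F + G` with `F`, `G` faces of `C`, `D` (`faceMulEquiv`), their lattices split in the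
same way, and the projection off `span F + span G` restricts to the projection off `span F` on `span
C` and to the one off `span G` on `span D`. So both the face and the transverse cone of a product
are products.

For the passage to linear combinations, orthogonality of vectors is a condition on supports, so
polar sets are coordinate subspaces. The same holds on the tensor square by `tensorRel_iff`: two
tensors are related exactly when their basis pairs are orthogonal. The partial products are
restrictions of globally defined bilinear maps, which makes the factorwise product independent of
presentations. An identity then needs checking only on the basis elements that occur.

The counit axioms hold because `t(C, F) = 0` only for `F = C` and `F = 0` only for the smallest
face. The coproduct respects dimension because `span C` is the orthogonal sum of the spans of `t(C,
F)` and `F`. -/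

/-! ### Faces of cones and linear spans -/

/-- The span of a cone is its set of differences `F - F`. -/
theorem PointedCone.exists_add_mem_of_mem_span {F : PointedCone ℝ RInf} {z : RInf}
    (hz : z ∈ Submodule.span ℝ (F : Set RInf)) : ∃ f ∈ F, z + f ∈ F := by
  induction hz using Submodule.span_induction with
  | mem z hz => exact ⟨0, zero_mem _, by simpa using hz⟩
  | zero => exact ⟨0, zero_mem _, by simp⟩
  | add u v _ _ hu hv =>
    obtain ⟨f, hf, hf'⟩ := hu
    obtain ⟨g, hg, hg'⟩ := hv
    exact ⟨f + g, add_mem hf hg, by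
      rw [show u + v + (f + g) = (u + f) + (v + g) by abel]; exact add_mem hf' hg'⟩
  | smul a u _ hu =>
    obtain ⟨f, hf, hf'⟩ := hu
    rcases le_total 0 a with ha | ha
    · exact ⟨a • f, F.smul_mem ha hf, by rw [← smul_add]; exact F.smul_mem ha hf'⟩
    -- A negative scalar exchanges the roles of the two elements `u + f` and `f` of `F` whose
    -- difference is `u`.
    · refine ⟨(-a) • (u + f), F.smul_mem (neg_nonneg.2 ha) hf', ?_⟩
      rw [show a • u + (-a) • (u + f) = (-a) • f by rw [smul_add, neg_smul a u]; abel]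
      exact F.smul_mem (neg_nonneg.2 ha) hf

/-- If `x` lies in a cone and is congruent to an element of a face modulo the span of a subface,
then it lies in the face. -/
theorem PointedCone.IsFaceOf.mem_of_sub_mem_span {C F G : PointedCone ℝ RInf}
    (hF : F.IsFaceOf C) (hGF : G ≤ F) {x f : RInf} (hx : x ∈ C) (hf : f ∈ F)
    (h : x - f ∈ Submodule.span ℝ (G : Set RInf)) : x ∈ F := by
  obtain ⟨g, hg, hg'⟩ := exists_add_mem_of_mem_span h
  -- Adding `g` moves `x` into `F`: `x + g` is the sum of `x - f + g` in `G` and `f` in `F`. The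
  -- face property then gives back `x`.
  refine hF.mem_of_add_mem_left hx (hF.le (hGF hg)) ?_
  rw [show x + g = (x - f + g) + f by abel]
  exact add_mem (hGF hg') hf

/-- A face is cut out of its cone by its own span. -/
theorem PointedCone.IsFaceOf.mem_of_mem_span {C F : PointedCone ℝ RInf}
    (hF : F.IsFaceOf C) {x : RInf} (hx : x ∈ C)
    (h : x ∈ Submodule.span ℝ (F : Set RInf)) : x ∈ F :=
  hF.mem_of_sub_mem_span le_rfl hx (zero_mem F) (by simpa using h)

theorem PointedCone.span_sup (C D : PointedCone ℝ RInf) :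
    Submodule.span ℝ ((C ⊔ D : PointedCone ℝ RInf) : Set RInf) =
      Submodule.span ℝ (C : Set RInf) ⊔ Submodule.span ℝ (D : Set RInf) := by
  apply le_antisymm
  · rw [Submodule.span_le]
    intro v hv
    obtain ⟨a, ha, b, hb, rfl⟩ := Submodule.mem_sup.1 (show v ∈ C ⊔ D from hv)
    exact Submodule.add_mem_sup (Submodule.subset_span ha) (Submodule.subset_span hb)
  · exact sup_le (Submodule.span_mono (show C ≤ C ⊔ D from le_sup_left))
      (Submodule.span_mono (show D ≤ C ⊔ D from le_sup_right))

/-! ### Geometry of lattice cones -/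

namespace LatticeCone

variable {Q : RationalInnerProduct} {C D E C' D' : LatticeCone}

theorem mem_lin_of_mem_cone {x : RInf} (hx : x ∈ C.cone) : x ∈ C.lin := Submodule.subset_span hx

theorem mem_lin_of_mem_lattice {x : RInf} (hx : x ∈ C.lattice) : x ∈ C.lin := by
  rw [lin_eq_span_lattice]; exact Submodule.subset_span hx

/-! ### Orthogonality -/

theorem Orthogonal.symm (h : Orthogonal Q C D) : Orthogonal Q D C := fun u hu v hv => by
  rw [Q.symm]; exact h v hv u hu

/-- Orthogonality depends only on spans. It is therefore inherited by faces and transverse cones,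
whose spans lie in that of the original cone. -/
theorem Orthogonal.mono (h : Orthogonal Q C D) (hC : C'.lin ≤ C.lin) (hD : D'.lin ≤ D.lin) :
    Orthogonal Q C' D' := fun _ hu _ hv =>
  h.lin (hC (mem_lin_of_mem_lattice hu)) (hD (mem_lin_of_mem_lattice hv))

theorem orthogonal_zero (Q : RationalInnerProduct) (C : LatticeCone) : Orthogonal Q C zero := by
  intro u _ v hv
  rw [show v = 0 from (Submodule.mem_bot ℤ).1 hv, map_zero]

theorem zero_orthogonal (Q : RationalInnerProduct) (C : LatticeCone) : Orthogonal Q zero C :=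
  (orthogonal_zero Q C).symm

/-- A common vector is orthogonal to itself, hence zero by positivity. -/
theorem Orthogonal.disjoint (h : Orthogonal Q C D) : Disjoint C.lin D.lin := by
  rw [Submodule.disjoint_def]
  intro x hx hy
  by_contra h0
  exact (Q.pos x h0).ne' (h.lin hx hy)

theorem Orthogonal.add_eq_add (h : Orthogonal Q C D) {c c' d d' : RInf} (hc : c ∈ C.lin)
    (hc' : c' ∈ C.lin) (hd : d ∈ D.lin) (hd' : d' ∈ D.lin) (e : c + d = c' + d') :
    c = c' ∧ d = d' := by
  have e' : c - c' = d' - d := by rw [sub_eq_sub_iff_add_eq_add, e, add_comm]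
  have h0 : c - c' = 0 := Submodule.disjoint_def.1 h.disjoint _ (sub_mem hc hc')
    (by rw [e']; exact sub_mem hd' hd)
  exact ⟨sub_eq_zero.1 h0, (sub_eq_zero.1 (by rw [← e', h0])).symm⟩

/-! ### Products -/

theorem mul_lin (h : Orthogonal Q C D) : (C.mul Q D h).lin = C.lin ⊔ D.lin :=
  PointedCone.span_sup C.cone D.cone

theorem orthogonal_mul (h : Orthogonal Q C D) (hC : Orthogonal Q E C) (hD : Orthogonal Q E D) :
    Orthogonal Q E (C.mul Q D h) := by
  intro u hu v hv
  obtain ⟨a, ha, b, hb, rfl⟩ := Submodule.mem_sup.1 hv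
  rw [map_add, hC u hu a ha, hD u hu b hb, add_zero]

theorem mul_orthogonal (h : Orthogonal Q C D) (hC : Orthogonal Q C E) (hD : Orthogonal Q D E) :
    Orthogonal Q (C.mul Q D h) E := (orthogonal_mul h hC.symm hD.symm).symm

theorem finrank_sup (h : Orthogonal Q C D) :
    Module.finrank ℝ (C.lin ⊔ D.lin : Submodule ℝ RInf) = C.dim + D.dim := by
  have := C.lin_finiteDimensional
  have := D.lin_finiteDimensional
  have e := Submodule.finrank_sup_add_finrank_inf_eq C.lin D.lin
  rwa [h.disjoint.eq_bot, finrank_bot, add_zero] at e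

theorem mul_dim (h : Orthogonal Q C D) : (C.mul Q D h).dim = C.dim + D.dim := by
  rw [dim, mul_lin, finrank_sup h]

theorem mul_zero (C : LatticeCone) (h : Orthogonal Q C zero) : C.mul Q zero h = C :=
  LatticeCone.ext (sup_bot_eq C.cone) (sup_bot_eq C.lattice)

theorem zero_mul (C : LatticeCone) (h : Orthogonal Q zero C) : zero.mul Q C h = C :=
  LatticeCone.ext (bot_sup_eq C.cone) (bot_sup_eq C.lattice)

theorem mul_assoc (h : Orthogonal Q C D) (h' : Orthogonal Q (C.mul Q D h) E)
    (k : Orthogonal Q D E) (k' : Orthogonal Q C (D.mul Q E k)) :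
    (C.mul Q D h).mul Q E h' = C.mul Q (D.mul Q E k) k' :=
  LatticeCone.ext (sup_assoc _ _ _) (sup_assoc _ _ _)

/-- The span contains both the cone and the lattice, so a lattice cone can be recognised as trivial
from its span alone. -/
theorem lin_eq_bot_iff : C.lin = ⊥ ↔ C = zero := by
  constructor
  · intro h
    refine LatticeCone.ext ?_ ?_
    · exact eq_bot_iff.2 fun x hx => by
        have := mem_lin_of_mem_cone hx
        rw [h] at this
        exact this
    · exact eq_bot_iff.2 fun x hx => by
        have := mem_lin_of_mem_lattice hx
        rw [h] at this
        exact this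
  · rintro rfl
    simp [lin, zero]

theorem dim_eq_zero_iff : C.dim = 0 ↔ C = zero := by
  have := C.lin_finiteDimensional
  rw [← lin_eq_bot_iff, dim, Submodule.finrank_eq_zero]

theorem mul_eq_zero_iff (h : Orthogonal Q C D) :
    C.mul Q D h = zero ↔ C = zero ∧ D = zero := by
  rw [← lin_eq_bot_iff, mul_lin, sup_eq_bot_iff, lin_eq_bot_iff, lin_eq_bot_iff]

/-! ### Faces and transverse cones -/

theorem face_lin (F : C.Face) : (C.face F).lin = Submodule.span ℝ (F.1 : Set RInf) := rfl

theorem face_lin_le (F : C.Face) : (C.face F).lin ≤ C.lin := Submodule.span_mono F.2.le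

theorem proj_mem_lin (h : D.lin ≤ C.lin) {x : RInf} (hx : x ∈ C.lin) : D.proj Q x ∈ C.lin := by
  have := sub_mem hx (h (D.sub_proj_mem Q x))
  rwa [sub_sub_cancel] at this

theorem proj_eq_zero_iff (Q : RationalInnerProduct) (D : LatticeCone) {x : RInf} :
    D.proj Q x = 0 ↔ x ∈ D.lin := by
  refine ⟨fun h => ?_, fun h => D.proj_eq_of Q (zero_mem _) (by simpa using h)⟩
  simpa [h] using D.sub_proj_mem Q x

theorem proj_eq_proj_iff (Q : RationalInnerProduct) (D : LatticeCone) {x y : RInf} :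
    D.proj Q x = D.proj Q y ↔ x - y ∈ D.lin := by
  rw [← proj_eq_zero_iff Q, map_sub, sub_eq_zero]

/-- Lets `G` as a face of `F` and `G` as a face of `C` define the same projection, whatever their
lattices. -/
theorem proj_congr (h : C.lin = D.lin) : C.proj Q = D.proj Q := by
  refine LinearMap.ext fun x => ?_
  exact C.proj_eq_of Q (by rw [h]; exact D.proj_mem Q _) (by rw [h]; exact D.sub_proj_mem Q _)

theorem map_proj_lin (F : LatticeCone) (K : PointedCone ℝ RInf) :
    Submodule.span ℝ ((K.map (F.proj Q) : PointedCone ℝ RInf) : Set RInf) =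
      (Submodule.span ℝ (K : Set RInf)).map (F.proj Q) := by
  rw [PointedCone.coe_map, ← Submodule.map_span]

theorem transverse_lin (F : C.Face) :
    (C.transverse Q F).lin = C.lin.map ((C.face F).proj Q) := map_proj_lin _ _

theorem transverse_lin_le (F : C.Face) : (C.transverse Q F).lin ≤ C.lin := by
  rw [transverse_lin]
  rintro _ ⟨x, hx, rfl⟩
  exact proj_mem_lin (face_lin_le F) hx

theorem transverse_orthogonal_face (F : C.Face) :
    Orthogonal Q (C.transverse Q F) (C.face F) := by
  rintro _ ⟨x, -, rfl⟩ v hv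
  rw [Q.symm]
  exact (C.face F).proj_mem Q x v (mem_lin_of_mem_lattice hv)

/-- Each vector is its projection plus a vector of `span F`. As the two summands are orthogonal,
dimensions add up. -/
theorem transverse_lin_sup_face_lin (F : C.Face) :
    (C.transverse Q F).lin ⊔ (C.face F).lin = C.lin := by
  refine le_antisymm (sup_le (transverse_lin_le F) (face_lin_le F)) fun x hx => ?_
  rw [← add_sub_cancel ((C.face F).proj Q x) x]
  refine Submodule.add_mem_sup ?_ (sub_proj_mem Q _ x)
  rw [transverse_lin]
  exact Submodule.mem_map_of_mem hx

theorem transverse_dim_add_face_dim (F : C.Face) :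
    (C.transverse Q F).dim + (C.face F).dim = C.dim := by
  rw [← finrank_sup (transverse_orthogonal_face F), transverse_lin_sup_face_lin, dim]

/-! ### The extreme faces -/

/-- The face `{0}`. -/
noncomputable def botFace (C : LatticeCone) : C.Face :=
  ⟨⊥, PointedCone.IsFaceOf.of_mem_of_add_mem_left bot_le fun {x y} hx hy h => by
    by_contra hne
    refine C.salient x hx hne ?_
    rw [neg_eq_of_add_eq_zero_right ((Submodule.mem_bot _).1 h)]
    exact hy⟩

/-- The cone itself, as a face. -/
noncomputable def topFace (C : LatticeCone) : C.Face := ⟨C.cone, .refl _⟩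

theorem face_botFace (C : LatticeCone) : C.face C.botFace = zero :=
  lin_eq_bot_iff.1 (by rw [face_lin]; simp [botFace])

theorem face_topFace (C : LatticeCone) : C.face C.topFace = C :=
  LatticeCone.ext rfl (inf_eq_left.2 fun _ hx => mem_lin_of_mem_lattice hx)

theorem face_eq_zero_iff {F : C.Face} : C.face F = zero ↔ F = C.botFace :=
  ⟨fun h => Subtype.ext (congrArg LatticeCone.cone h), fun h => h ▸ face_botFace C⟩

theorem transverse_botFace (C : LatticeCone) : C.transverse Q C.botFace = C := by
  have h : (C.face C.botFace).proj Q = LinearMap.id := LinearMap.ext fun x =>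
    proj_eq_of Q _ (fun w hw => by
      rw [lin_eq_bot_iff.2 (face_botFace C), Submodule.mem_bot] at hw
      simp [hw]) (by simp)
  refine LatticeCone.ext ?_ ?_
  · change C.cone.map _ = _
    rw [h]; exact Submodule.map_id _
  · change C.lattice.map _ = _
    rw [h]; exact Submodule.map_id _

/-- The transverse cone vanishes when `C` lies in the kernel `span F` of the projection, and `C ∩
span F = F`. -/
theorem transverse_eq_zero_iff {F : C.Face} : C.transverse Q F = zero ↔ F = C.topFace := by
  rw [← lin_eq_bot_iff, transverse_lin, eq_bot_iff, Submodule.map_le_iff_le_comap]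
  constructor
  · intro h
    refine Subtype.ext (le_antisymm F.2.le fun x hx => F.2.mem_of_mem_span hx ?_)
    exact (proj_eq_zero_iff Q (C.face F)).1 (h (mem_lin_of_mem_cone hx))
  · rintro rfl x hx
    exact (proj_eq_zero_iff Q (C.face C.topFace)).2 hx

/-! ### Faces of products -/

theorem mem_of_mem_sup_of_mem_lin (h : Orthogonal Q C D) {F G : PointedCone ℝ RInf}
    (hF : F ≤ C.cone) (hG : G ≤ D.cone) {x : RInf} (hx : x ∈ F ⊔ G) (hxC : x ∈ C.lin) :
    x ∈ F := by
  obtain ⟨f, hf, g, hg, rfl⟩ := Submodule.mem_sup.1 hx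
  have := (h.add_eq_add (mem_lin_of_mem_cone (hF hf)) hxC (mem_lin_of_mem_cone (hG hg))
    (zero_mem _) (add_zero _).symm).2
  rwa [this, add_zero]

/-- By unique decomposition, a sum lying in `F + G` has its components in `F` and in `G`, where the
two face properties apply separately. -/
theorem isFaceOf_sup (h : Orthogonal Q C D) (F : C.Face) (G : D.Face) :
    (F.1 ⊔ G.1).IsFaceOf (C.cone ⊔ D.cone) := by
  refine .of_mem_of_add_mem_left (sup_le_sup F.2.le G.2.le) fun {x y} hx hy hxy => ?_
  obtain ⟨c, hc, d, hd, rfl⟩ := Submodule.mem_sup.1 hx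
  obtain ⟨c', hc', d', hd', rfl⟩ := Submodule.mem_sup.1 hy
  obtain ⟨f, hf, g, hg, e⟩ := Submodule.mem_sup.1 hxy
  rw [add_add_add_comm] at e
  obtain ⟨rfl, rfl⟩ := h.add_eq_add (mem_lin_of_mem_cone (F.2.le hf))
    (mem_lin_of_mem_cone (add_mem hc hc')) (mem_lin_of_mem_cone (G.2.le hg))
    (mem_lin_of_mem_cone (add_mem hd hd')) e
  exact Submodule.add_mem_sup (F.2.mem_of_add_mem_left hc hc' hf)
    (G.2.mem_of_add_mem_left hd hd' hg)

/-- The faces of a product of orthogonal lattice cones are the products of faces. -/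
noncomputable def faceMulEquiv (h : Orthogonal Q C D) :
    C.Face × D.Face ≃ (C.mul Q D h).Face where
  toFun P := ⟨P.1.1 ⊔ P.2.1, isFaceOf_sup h P.1 P.2⟩
  invFun H :=
    (⟨H.1 ⊓ C.cone, by
        have := H.2.inf (.refl C.cone)
        rwa [inf_eq_right.2 (show C.cone ≤ (C.mul Q D h).cone from le_sup_left)] at this⟩,
      ⟨H.1 ⊓ D.cone, by
        have := H.2.inf (.refl D.cone)
        rwa [inf_eq_right.2 (show D.cone ≤ (C.mul Q D h).cone from le_sup_right)] at this⟩)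
  left_inv := by
    rintro ⟨F, G⟩
    refine Prod.ext (Subtype.ext ?_) (Subtype.ext ?_)
    · refine le_antisymm (fun x hx => ?_) (le_inf le_sup_left F.2.le)
      exact mem_of_mem_sup_of_mem_lin h F.2.le G.2.le hx.1 (mem_lin_of_mem_cone hx.2)
    · refine le_antisymm (fun x hx => ?_) (le_inf le_sup_right G.2.le)
      refine mem_of_mem_sup_of_mem_lin h.symm G.2.le F.2.le ?_ (mem_lin_of_mem_cone hx.2)
      rw [sup_comm]
      exact hx.1
  right_inv := by
    intro H
    refine Subtype.ext (le_antisymm (sup_le inf_le_left inf_le_left) fun x hx => ?_)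
    obtain ⟨c, hc, d, hd, rfl⟩ := Submodule.mem_sup.1 (show x ∈ C.cone ⊔ D.cone from H.2.le hx)
    -- A face containing `c + d` contains both summands, so `H` is generated by its intersections
    -- with the two cones.
    have := (H.2.add_mem_iff_mem (show c ∈ C.cone ⊔ D.cone from Submodule.mem_sup_left hc)
      (show d ∈ C.cone ⊔ D.cone from Submodule.mem_sup_right hd)).1 hx
    exact Submodule.add_mem_sup ⟨this.1, hc⟩ ⟨this.2, hd⟩

theorem face_faceMulEquiv (h : Orthogonal Q C D) (F : C.Face) (G : D.Face)
    (h' : Orthogonal Q (C.face F) (D.face G)) :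
    (C.mul Q D h).face (faceMulEquiv h (F, G)) = (C.face F).mul Q (D.face G) h' := by
  have hs : ((C.mul Q D h).face (faceMulEquiv h (F, G))).lin = (C.face F).lin ⊔ (D.face G).lin :=
    PointedCone.span_sup F.1 G.1
  refine LatticeCone.ext rfl (le_antisymm ?_ ?_)
  · rintro x ⟨hx, hx'⟩
    obtain ⟨c, hc, d, hd, rfl⟩ :=
      Submodule.mem_sup.1 (show x ∈ C.lattice ⊔ D.lattice from hx)
    replace hx' : c + d ∈ (C.face F).lin ⊔ (D.face G).lin := by rw [← hs]; exact hx'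
    obtain ⟨f, hf, g, hg, e⟩ := Submodule.mem_sup.1 hx'
    -- The lattice decomposition and the decomposition along `span F + span G` coincide, so each
    -- lattice component lies in the span of its own face.
    obtain ⟨rfl, rfl⟩ := h.add_eq_add (face_lin_le F hf) (mem_lin_of_mem_lattice hc)
      (face_lin_le G hg) (mem_lin_of_mem_lattice hd) e
    exact Submodule.add_mem_sup ⟨hc, hf⟩ ⟨hd, hg⟩
  · refine sup_le ?_ ?_
    · rintro x ⟨hx, hx'⟩
      refine ⟨Submodule.mem_sup_left hx, ?_⟩
      change x ∈ ((C.mul Q D h).face (faceMulEquiv h (F, G))).lin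
      rw [hs]
      exact Submodule.mem_sup_left hx'
    · rintro x ⟨hx, hx'⟩
      refine ⟨Submodule.mem_sup_right hx, ?_⟩
      change x ∈ ((C.mul Q D h).face (faceMulEquiv h (F, G))).lin
      rw [hs]
      exact Submodule.mem_sup_right hx'

/-- The projection of `x` off `C'` stays in `C.lin`, so it is already orthogonal to `D'`. -/
theorem proj_eq_proj_of_orthogonal {x : RInf} (hE : E.lin = C'.lin ⊔ D'.lin)
    (h : Orthogonal Q C D) (hC : C'.lin ≤ C.lin) (hD : D'.lin ≤ D.lin) (hx : x ∈ C.lin) :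
    E.proj Q x = C'.proj Q x := by
  refine E.proj_eq_of Q ?_ ?_
  · intro w hw
    rw [hE] at hw
    obtain ⟨a, ha, b, hb, rfl⟩ := Submodule.mem_sup.1 hw
    rw [map_add, LinearMap.add_apply, C'.proj_mem Q x a ha, Q.symm,
      h.lin (proj_mem_lin hC hx) (hD hb), add_zero]
  · rw [hE]
    exact Submodule.mem_sup_left (C'.sub_proj_mem Q x)

theorem transverse_faceMulEquiv (h : Orthogonal Q C D) (F : C.Face) (G : D.Face)
    (h' : Orthogonal Q (C.transverse Q F) (D.transverse Q G)) :
    (C.mul Q D h).transverse Q (faceMulEquiv h (F, G)) =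
      (C.transverse Q F).mul Q (D.transverse Q G) h' := by
  have hs : ((C.mul Q D h).face (faceMulEquiv h (F, G))).lin = (C.face F).lin ⊔ (D.face G).lin :=
    PointedCone.span_sup F.1 G.1
  have hC : ∀ x ∈ C.lin, ((C.mul Q D h).face (faceMulEquiv h (F, G))).proj Q x =
      (C.face F).proj Q x := fun x hx =>
    proj_eq_proj_of_orthogonal hs h (face_lin_le F) (face_lin_le G) hx
  have hD : ∀ x ∈ D.lin, ((C.mul Q D h).face (faceMulEquiv h (F, G))).proj Q x =
      (D.face G).proj Q x := fun x hx =>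
    proj_eq_proj_of_orthogonal (hs.trans (sup_comm _ _)) h.symm (face_lin_le G) (face_lin_le F) hx
  refine LatticeCone.ext ((Submodule.map_sup _ _ _).trans (congrArg₂ (· ⊔ ·) ?_ ?_))
    ((Submodule.map_sup _ _ _).trans (congrArg₂ (· ⊔ ·) ?_ ?_))
  · exact SetLike.coe_injective (Set.image_congr fun x hx => hC x (mem_lin_of_mem_cone hx))
  · exact SetLike.coe_injective (Set.image_congr fun x hx => hD x (mem_lin_of_mem_cone hx))
  · exact SetLike.coe_injective (Set.image_congr fun x hx => hC x (mem_lin_of_mem_lattice hx))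
  · exact SetLike.coe_injective (Set.image_congr fun x hx => hD x (mem_lin_of_mem_lattice hx))

/-! ### Faces of faces and faces of transverse cones -/

/-- The faces of a face `F` are the faces of the cone contained in `F`. -/
noncomputable def faceFaceEquiv (F : C.Face) :
    (C.face F).Face ≃ {G : C.Face // G.1 ≤ F.1} where
  toFun G := ⟨⟨G.1, G.2.trans F.2⟩, G.2.le⟩
  invFun G := ⟨G.1.1, (PointedCone.IsFaceOf.isFaceOf_iff_le G.1.2 F.2).2 G.2⟩
  left_inv _ := rfl
  right_inv _ := rfl

theorem face_face (F : C.Face) (G : {G : C.Face // G.1 ≤ F.1}) :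
    (C.face F).face ((faceFaceEquiv F).symm G) = C.face G.1 := by
  refine LatticeCone.ext rfl (le_antisymm (fun x hx => ⟨hx.1.1, hx.2⟩) fun x hx => ?_)
  exact ⟨⟨hx.1, Submodule.span_mono G.2 hx.2⟩, hx.2⟩

theorem isFaceOf_comap_proj (G : C.Face) (H : (C.transverse Q G).Face) :
    (PointedCone.comap ((C.face G).proj Q) H.1 ⊓ C.cone).IsFaceOf C.cone := by
  refine .of_mem_of_add_mem_left inf_le_right fun {x y} hx hy hxy => ⟨?_, hx⟩
  have hxy' : (C.face G).proj Q x + (C.face G).proj Q y ∈ H.1 := by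
    rw [← map_add]; exact hxy.1
  exact H.2.mem_of_add_mem_left (PointedCone.mem_map.2 ⟨x, hx, rfl⟩)
    (PointedCone.mem_map.2 ⟨y, hy, rfl⟩) hxy'

theorem le_comap_proj (G : C.Face) (H : (C.transverse Q G).Face) :
    G.1 ≤ PointedCone.comap ((C.face G).proj Q) H.1 ⊓ C.cone := by
  refine le_inf (fun x hx => ?_) G.2.le
  have h : (C.face G).proj Q x = 0 := (proj_eq_zero_iff Q (C.face G)).2 (mem_lin_of_mem_cone hx)
  change (C.face G).proj Q x ∈ H.1
  rw [h]
  exact zero_mem _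

/-- Linear images of faces need not be faces. Here the kernel is `span G` with `G ≤ F`, so an
element of `C` with the same image as an element of `F` is itself in `F`. -/
theorem isFaceOf_map_proj (Q : RationalInnerProduct) {F G : C.Face} (h : G.1 ≤ F.1) :
    (F.1.map ((C.face G).proj Q)).IsFaceOf (C.transverse Q G).cone := by
  refine .of_mem_of_add_mem_left (Submodule.map_mono F.2.le) fun {u v} hu hv huv => ?_
  obtain ⟨x, hx, rfl⟩ := PointedCone.mem_map.1 hu
  obtain ⟨y, hy, rfl⟩ := PointedCone.mem_map.1 hv
  obtain ⟨f, hf, e⟩ := PointedCone.mem_map.1 huv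
  rw [← map_add] at e
  exact PointedCone.mem_map.2 ⟨x, F.2.mem_of_add_mem_left hx hy
    (F.2.mem_of_sub_mem_span h (add_mem hx hy) hf ((proj_eq_proj_iff Q (C.face G)).1 e.symm)), rfl⟩

/-- The faces of the transverse cone along a face `G` are the projections of the faces of the cone
containing `G`. -/
noncomputable def faceTransverseEquiv (Q : RationalInnerProduct) (G : C.Face) :
    (C.transverse Q G).Face ≃ {F : C.Face // G.1 ≤ F.1} where
  toFun H := ⟨⟨_, isFaceOf_comap_proj G H⟩, le_comap_proj G H⟩
  invFun F := ⟨F.1.1.map ((C.face G).proj Q), isFaceOf_map_proj Q F.2⟩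
  left_inv := by
    intro H
    refine Subtype.ext (le_antisymm (fun y hy => ?_) fun y hy => ?_)
    · obtain ⟨x, hx, rfl⟩ := PointedCone.mem_map.1 hy
      exact hx.1
    · obtain ⟨x, hx, rfl⟩ := PointedCone.mem_map.1 (H.2.le hy)
      exact PointedCone.mem_map.2 ⟨x, ⟨hy, hx⟩, rfl⟩
  right_inv := by
    intro F
    refine Subtype.ext (Subtype.ext (le_antisymm (fun x hx => ?_) fun x hx =>
      ⟨PointedCone.mem_map.2 ⟨x, hx, rfl⟩, F.1.2.le hx⟩))
    obtain ⟨f, hf, e⟩ := PointedCone.mem_map.1 hx.1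
    exact F.1.2.mem_of_sub_mem_span F.2 hx.2 hf ((proj_eq_proj_iff Q (C.face G)).1 e.symm)

theorem faceTransverseEquiv_symm_lin (F G : C.Face) (h : G.1 ≤ F.1) :
    ((C.transverse Q G).face ((faceTransverseEquiv Q G).symm ⟨F, h⟩)).lin =
      (C.face F).lin.map ((C.face G).proj Q) := map_proj_lin _ _

/-- The point is the lattice: projecting `Λ_C` and then intersecting with the image of `span F`
gives the same as projecting `Λ_C ∩ span F`, because the kernel `span G` is contained in `span F`.
-/
theorem face_transverse (F G : C.Face) (h : G.1 ≤ F.1) :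
    (C.transverse Q G).face ((faceTransverseEquiv Q G).symm ⟨F, h⟩) =
      (C.face F).transverse Q ((faceFaceEquiv F).symm ⟨G, h⟩) := by
  have hp : ((C.face F).face ((faceFaceEquiv F).symm ⟨G, h⟩)).proj Q = (C.face G).proj Q :=
    proj_congr rfl
  have hl := faceTransverseEquiv_symm_lin (Q := Q) F G h
  refine LatticeCone.ext ?_ (SetLike.ext fun y => ?_)
  · change F.1.map _ = F.1.map _
    rw [hp]
  · have h1 : y ∈ ((C.transverse Q G).face ((faceTransverseEquiv Q G).symm ⟨F, h⟩)).lattice ↔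
        (∃ x ∈ C.lattice, (C.face G).proj Q x = y) ∧
          y ∈ (C.face F).lin.map ((C.face G).proj Q) := by
      rw [← hl]; exact Iff.rfl
    have h2 : y ∈ ((C.face F).transverse Q ((faceFaceEquiv F).symm ⟨G, h⟩)).lattice ↔
        ∃ x ∈ (C.face F).lattice, (C.face G).proj Q x = y := by
      rw [← hp]; exact Iff.rfl
    rw [h1, h2]
    constructor
    · rintro ⟨⟨x, hx, rfl⟩, z, hz, e⟩
      refine ⟨x, ⟨hx, ?_⟩, rfl⟩
      have := Submodule.span_mono h ((proj_eq_proj_iff Q (C.face G)).1 e.symm)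
      have := add_mem this hz
      rwa [sub_add_cancel] at this
    · rintro ⟨x, hx, rfl⟩
      exact ⟨⟨x, hx.1, rfl⟩, x, hx.2, rfl⟩

/-- Transitivity of projections: `span F` is the orthogonal sum of `span G` and its image under the
projection off `G`, so the two parts can be removed in succession. -/
theorem proj_transverse_face (F G : C.Face) (h : G.1 ≤ F.1) (x : RInf) :
    ((C.transverse Q G).face ((faceTransverseEquiv Q G).symm ⟨F, h⟩)).proj Q
      ((C.face G).proj Q x) = (C.face F).proj Q x := by
  set H := (C.transverse Q G).face ((faceTransverseEquiv Q G).symm ⟨F, h⟩)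
  have hl : H.lin = (C.face F).lin.map ((C.face G).proj Q) := faceTransverseEquiv_symm_lin F G h
  have hGF : (C.face G).lin ≤ (C.face F).lin := Submodule.span_mono h
  symm
  have hd := H.sub_proj_mem Q ((C.face G).proj Q x)
  refine proj_eq_of Q _ ?_ ?_
  · intro w hw
    rw [hl] at hd
    obtain ⟨y, -, e⟩ := hd
    have h1 := H.proj_mem Q ((C.face G).proj Q x) ((C.face G).proj Q w)
      (by rw [hl]; exact ⟨w, hw, rfl⟩)
    -- The first argument lies in `span G`. The second is a difference of projections of `x` and `y`
    -- off `G`, hence orthogonal to `span G`.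
    have h2 : Q.form (w - (C.face G).proj Q w) (H.proj Q ((C.face G).proj Q x)) = 0 := by
      rw [← sub_sub_cancel ((C.face G).proj Q x) (H.proj Q ((C.face G).proj Q x)), ← e, map_sub,
        (C.face G).proj_mem Q x _ ((C.face G).sub_proj_mem Q w),
        (C.face G).proj_mem Q y _ ((C.face G).sub_proj_mem Q w), sub_zero]
    rwa [map_sub, LinearMap.sub_apply, h1, sub_zero] at h2
  · rw [← sub_add_sub_cancel x ((C.face G).proj Q x)]
    refine add_mem (hGF ((C.face G).sub_proj_mem Q x)) ?_
    rw [hl] at hd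
    obtain ⟨y, hy, e⟩ := hd
    rw [← e]
    exact proj_mem_lin hGF hy

theorem transverse_transverse (F G : C.Face) (h : G.1 ≤ F.1) :
    (C.transverse Q G).transverse Q ((faceTransverseEquiv Q G).symm ⟨F, h⟩) =
      C.transverse Q F := by
  refine LatticeCone.ext (SetLike.coe_injective ?_) (SetLike.coe_injective ?_)
  · exact (Set.image_image _ _ _).trans
      (Set.image_congr fun x _ => proj_transverse_face F G h x)
  · exact (Set.image_image _ _ _).trans
      (Set.image_congr fun x _ => proj_transverse_face F G h x)

end LatticeCone

/-! ### Bilinear maps on spans -/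

namespace Submodule

variable {K M N P : Type*} [Field K] [AddCommGroup M] [Module K M] [AddCommGroup N] [Module K N]
  [AddCommGroup P] [Module K P]

/-- Meant for `S` and `T` the basis elements occurring in `x` and `y`: the product behaves well only
on orthogonal basis elements, so extension from a whole basis is not available. -/
theorem bilin_mem_of_mem_span (f : M →ₗ[K] N →ₗ[K] P) {S : Set M} {T : Set N}
    {R : Submodule K P} (h : ∀ s ∈ S, ∀ t ∈ T, f s t ∈ R) {x : M} {y : N}
    (hx : x ∈ span K S) (hy : y ∈ span K T) : f x y ∈ R := by
  have h1 := apply_mem_map₂ f hx hy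
  rw [map₂_span_span] at h1
  refine span_le.2 ?_ h1
  rintro _ ⟨s, hs, t, ht, rfl⟩
  exact h s hs t ht

theorem bilin_eq_of_mem_span (f g : M →ₗ[K] N →ₗ[K] P) {S : Set M} {T : Set N}
    (h : ∀ s ∈ S, ∀ t ∈ T, f s t = g s t) {x : M} {y : N}
    (hx : x ∈ span K S) (hy : y ∈ span K T) : f x y = g x y :=
  sub_eq_zero.1 <| (mem_bot K).1 <| bilin_mem_of_mem_span (f - g)
    (fun s hs t ht => (mem_bot K).2 (sub_eq_zero.2 (h s hs t ht))) hx hy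

theorem bilin_assoc_of_mem_span (m : M →ₗ[K] M →ₗ[K] M) {S T U : Set M}
    (h : ∀ s ∈ S, ∀ t ∈ T, ∀ u ∈ U, m (m s t) u = m s (m t u)) {x y z : M}
    (hx : x ∈ span K S) (hy : y ∈ span K T) (hz : z ∈ span K U) :
    m (m x y) z = m x (m y z) := by
  have h1 : ∀ s ∈ S, m (m s y) z = m s (m y z) := fun s hs =>
    bilin_eq_of_mem_span (m ∘ₗ m s) (m.compr₂ (m s)) (fun t ht u hu => h s hs t ht u hu) hy hz
  induction hx using span_induction with
  | mem s hs => exact h1 s hs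
  | zero => simp
  | add a b _ _ ha hb => simp only [map_add, LinearMap.add_apply, ha, hb]
  | smul c a _ ha => simp only [map_smul, LinearMap.smul_apply, ha]

end Submodule

/-! ### The locality bialgebra structure on the space of lattice cones -/

namespace ConeSpace

open LatticeCone

variable {Q : RationalInnerProduct}

/-- The basis element of `ℚ𝒞` given by a lattice cone. -/
noncomputable abbrev of (C : LatticeCone) : ConeSpace := Finsupp.single C 1

theorem mem_span_of (x : ConeSpace) :
    x ∈ Submodule.span ℚ (of '' (x.support : Set LatticeCone)) := by
  rw [← Finsupp.supported_eq_span_single]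
  exact Finsupp.mem_supported_support ℚ x

theorem of_mem_supported {S : Set LatticeCone} {C : LatticeCone} (h : C ∈ S) :
    of C ∈ Finsupp.supported ℚ ℚ S := Finsupp.single_mem_supported ℚ 1 h

theorem mem_support_of {C D : LatticeCone} : D ∈ (of C).support ↔ D = C := by
  rw [Finsupp.support_single C one_ne_zero, Finset.mem_singleton]

/-! ### The locality relation -/

theorem rel_symm {x y : ConeSpace} (h : rel Q x y) : rel Q y x :=
  fun C hC D hD => (h D hD C hC).symm

theorem rel_of_of {C D : LatticeCone} : rel Q (of C) (of D) ↔ Orthogonal Q C D := by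
  simp only [rel, mem_support_of, forall_eq]

theorem polar_rel (Q : RationalInnerProduct) (U : Set ConeSpace) :
    polar (rel Q) U = (Finsupp.supported ℚ ℚ
      {D | ∀ u ∈ U, ∀ C ∈ u.support, Orthogonal Q C D} : Submodule ℚ ConeSpace) := by
  ext x
  exact ⟨fun h D hD u hu C hC => h u hu C hC D hD, fun h u hu C hC D hD => h hD u hu C hC⟩

theorem of_mem_polar {U : Set ConeSpace} {C : LatticeCone} :
    of C ∈ polar (rel Q) U ↔ ∀ u ∈ U, ∀ D ∈ u.support, Orthogonal Q D C := by
  simp only [polar, rel, Set.mem_ofPred_eq, mem_support_of, forall_eq]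

theorem isLocalityVectorSpace (Q : RationalInnerProduct) : IsLocalityVectorSpace ℚ (rel Q) where
  symm _ _ := rel_symm
  polar_subspace U := ⟨_, (polar_rel Q U).symm⟩

/-! ### The product -/

open Classical in
/-- The bilinear extension by zero of the Minkowski product to all pairs. -/
noncomputable def mulBilin (Q : RationalInnerProduct) :
    ConeSpace →ₗ[ℚ] ConeSpace →ₗ[ℚ] ConeSpace :=
  Finsupp.linearCombination ℚ fun C => Finsupp.linearCombination ℚ fun D =>
    if h : Orthogonal Q C D then of (C.mul Q D h) else 0

/-- Replaces the partial product by a total bilinear map; additivity and homogeneity then come for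
free. -/
theorem mul_eq_mulBilin (x y : ConeSpace) (h : rel Q x y) : mul Q x y h = mulBilin Q x y := by
  rw [mulBilin, Finsupp.linearCombination_apply, LinearMap.finsupp_sum_apply, mul]
  refine Finsupp.sum_congr fun C _ => ?_
  rw [LinearMap.smul_apply, Finsupp.linearCombination_apply, Finsupp.smul_sum]
  refine Finsupp.sum_congr fun D _ => ?_
  split_ifs <;> simp

theorem mulBilin_of_of {C D : LatticeCone} (h : Orthogonal Q C D) :
    mulBilin Q (of C) (of D) = of (C.mul Q D h) := by
  simp only [mulBilin, of, Finsupp.linearCombination_single, one_smul, dif_pos h]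

theorem mulBilin_one (x : ConeSpace) : mulBilin Q x one = x := by
  have h : (mulBilin Q).flip one = LinearMap.id := by
    refine Finsupp.lhom_ext' fun C => LinearMap.ext_ring ?_
    exact (mulBilin_of_of (orthogonal_zero Q C)).trans (congrArg of (mul_zero C _))
  exact LinearMap.congr_fun h x

theorem one_mulBilin (x : ConeSpace) : mulBilin Q one x = x := by
  have h : mulBilin Q one = LinearMap.id := by
    refine Finsupp.lhom_ext' fun C => LinearMap.ext_ring ?_
    exact (mulBilin_of_of (zero_orthogonal Q C)).trans (congrArg of (zero_mul C _))
  exact LinearMap.congr_fun h x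

theorem mulBilin_mem {x y : ConeSpace} (h : rel Q x y) {R : Submodule ℚ ConeSpace}
    (hR : ∀ C ∈ x.support, ∀ D ∈ y.support, ∀ h : Orthogonal Q C D, of (C.mul Q D h) ∈ R) :
    mulBilin Q x y ∈ R := by
  refine Submodule.bilin_mem_of_mem_span _ ?_ (mem_span_of x) (mem_span_of y)
  rintro _ ⟨C, hC, rfl⟩ _ ⟨D, hD, rfl⟩
  rw [mulBilin_of_of (h C hC D hD)]
  exact hR C hC D hD _

theorem mulBilin_assoc {x y z : ConeSpace} (hxy : rel Q x y) (hyz : rel Q y z)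
    (hxz : rel Q x z) :
    mulBilin Q (mulBilin Q x y) z = mulBilin Q x (mulBilin Q y z) := by
  refine Submodule.bilin_assoc_of_mem_span _ ?_ (mem_span_of x) (mem_span_of y) (mem_span_of z)
  rintro _ ⟨C, hC, rfl⟩ _ ⟨D, hD, rfl⟩ _ ⟨E, hE, rfl⟩
  have h1 := hxy C hC D hD
  have h2 := hyz D hD E hE
  have h3 := hxz C hC E hE
  rw [mulBilin_of_of h1, mulBilin_of_of h2, mulBilin_of_of (mul_orthogonal h1 h3 h2),
    mulBilin_of_of (orthogonal_mul h2 h1 h3), LatticeCone.mul_assoc h1]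

theorem isLocalityAlgebra (Q : RationalInnerProduct) :
    IsLocalityAlgebra ℚ (rel Q) (mul Q) one where
  toIsLocalityVectorSpace := isLocalityVectorSpace Q
  add_mul x x' y _ _ _ := by simp only [mul_eq_mulBilin, map_add, LinearMap.add_apply]
  mul_add x y y' _ _ _ := by simp only [mul_eq_mulBilin, map_add]
  smul_mul k x y _ _ := by simp only [mul_eq_mulBilin, map_smul, LinearMap.smul_apply]
  mul_smul k x y _ _ := by simp only [mul_eq_mulBilin, map_smul]
  mul_mem_polar U x y h hx hy := by
    rw [mul_eq_mulBilin, polar_rel]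
    rw [polar_rel] at hx hy
    exact mulBilin_mem h fun C hC D hD h => of_mem_supported fun u hu E hE =>
      orthogonal_mul h (hx hC u hu E hE) (hy hD u hu E hE)
  mul_assoc x y z hxy hyz hxz _ _ := by
    simp only [mul_eq_mulBilin]
    exact mulBilin_assoc hxy hyz hxz
  polar_one := by
    rw [polar_rel]
    refine Set.eq_univ_of_forall fun x D _ u hu C hC => ?_
    rw [Set.mem_singleton_iff.1 hu] at hC
    rw [mem_support_of.1 hC]
    exact zero_orthogonal Q D
  mul_one x _ := by rw [mul_eq_mulBilin, mulBilin_one]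
  one_mul x _ := by rw [mul_eq_mulBilin, one_mulBilin]

/-! ### Supports of tensors -/

/-- The pairs of lattice cones appearing in an element of `ℚ𝒞 ⊗ ℚ𝒞`. -/
noncomputable def pairSupport (t : ConeSpace ⊗[ℚ] ConeSpace) : Finset (LatticeCone × LatticeCone) :=
  (finsuppTensorFinsupp' ℚ LatticeCone LatticeCone t).support

/-- The tensors all of whose pairs of lattice cones belong to `P`. -/
noncomputable def pairSupported (P : Set (LatticeCone × LatticeCone)) :
    Submodule ℚ (ConeSpace ⊗[ℚ] ConeSpace) :=
  (Finsupp.supported ℚ ℚ P).comap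
    (finsuppTensorFinsupp' ℚ LatticeCone LatticeCone : _ →ₗ[ℚ] _)

theorem mem_pairSupported {P : Set (LatticeCone × LatticeCone)} {t : ConeSpace ⊗[ℚ] ConeSpace} :
    t ∈ pairSupported P ↔ ∀ p ∈ pairSupport t, p ∈ P := Iff.rfl

theorem of_tmul_of_mem_pairSupported {P : Set (LatticeCone × LatticeCone)} {C D : LatticeCone}
    (h : (C, D) ∈ P) : of C ⊗ₜ[ℚ] of D ∈ pairSupported P := by
  change finsuppTensorFinsupp' ℚ LatticeCone LatticeCone _ ∈ Finsupp.supported ℚ ℚ P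
  rw [finsuppTensorFinsupp'_single_tmul_single, mul_one]
  exact Finsupp.single_mem_supported ℚ 1 h

/-- The coefficient at `p` is the sum of the products `a i p.1 * b i p.2`. Cancellation can only
remove pairs, so a surviving pair occurs in some term. -/
theorem exists_mem_support_of_mem_pairSupport {n : ℕ} {a b : Fin n → ConeSpace}
    {p : LatticeCone × LatticeCone} (hp : p ∈ pairSupport (∑ i, a i ⊗ₜ[ℚ] b i)) :
    ∃ i, p.1 ∈ (a i).support ∧ p.2 ∈ (b i).support := by
  rw [pairSupport, Finsupp.mem_support_iff, map_sum, Finsupp.finsetSum_apply] at hp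
  obtain ⟨i, -, hi⟩ := Finset.exists_ne_zero_of_sum_ne_zero hp
  rw [finsuppTensorFinsupp'_apply_apply _] at hi
  exact ⟨i, Finsupp.mem_support_iff.2 (left_ne_zero_of_mul hi),
    Finsupp.mem_support_iff.2 (right_ne_zero_of_mul hi)⟩

theorem tmul_mem_pairSupported {P : Set (LatticeCone × LatticeCone)} {x y : ConeSpace}
    (h : ∀ C ∈ x.support, ∀ D ∈ y.support, (C, D) ∈ P) : x ⊗ₜ[ℚ] y ∈ pairSupported P := by
  refine Submodule.bilin_mem_of_mem_span (TensorProduct.mk ℚ ConeSpace ConeSpace) ?_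
    (mem_span_of x) (mem_span_of y)
  rintro _ ⟨C, hC, rfl⟩ _ ⟨D, hD, rfl⟩
  exact of_tmul_of_mem_pairSupported (h C hC D hD)

theorem eq_sum_pairSupport (t : ConeSpace ⊗[ℚ] ConeSpace) :
    t = ∑ p ∈ pairSupport t, Finsupp.single p.1 (finsuppTensorFinsupp' ℚ _ _ t p) ⊗ₜ[ℚ] of p.2 := by
  apply (finsuppTensorFinsupp' ℚ LatticeCone LatticeCone).injective
  rw [map_sum]
  simp only [finsuppTensorFinsupp'_single_tmul_single, mul_one]
  exact (Finsupp.sum_single _).symm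

theorem mem_span_of_tmul_of (t : ConeSpace ⊗[ℚ] ConeSpace) :
    t ∈ Submodule.span ℚ ((fun p : LatticeCone × LatticeCone => of p.1 ⊗ₜ[ℚ] of p.2) ''
      (pairSupport t : Set (LatticeCone × LatticeCone))) := by
  refine Set.mem_of_eq_of_mem (eq_sum_pairSupport t) (Submodule.sum_mem _ fun p hp => ?_)
  rw [← mul_one (finsuppTensorFinsupp' ℚ LatticeCone LatticeCone t p), ← smul_eq_mul,
    ← Finsupp.smul_single, ← TensorProduct.smul_tmul']
  exact Submodule.smul_mem _ _ (Submodule.subset_span ⟨p, hp, rfl⟩)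

theorem of_tmul_of_mem_localityTensor {X Y : Set ConeSpace} {C D : LatticeCone}
    (h : Orthogonal Q C D) (hC : of C ∈ X) (hD : of D ∈ Y) :
    of C ⊗ₜ[ℚ] of D ∈ localityTensor ℚ (rel Q) X Y :=
  Submodule.subset_span ⟨_, hC, _, hD, rel_of_of.2 h, rfl⟩

theorem mem_localityTensorSquare {t : ConeSpace ⊗[ℚ] ConeSpace} :
    t ∈ localityTensorSquare ℚ (rel Q) ↔ ∀ p ∈ pairSupport t, Orthogonal Q p.1 p.2 := by
  constructor
  · intro h
    refine mem_pairSupported.1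
      (Submodule.span_le.2 ?_ h : t ∈ pairSupported {p | Orthogonal Q p.1 p.2})
    rintro _ ⟨x, -, y, -, hxy, rfl⟩
    exact tmul_mem_pairSupported hxy
  · intro h
    refine Submodule.span_le.2 ?_ (mem_span_of_tmul_of t)
    rintro _ ⟨p, hp, rfl⟩
    exact of_tmul_of_mem_localityTensor (h p hp) trivial trivial

/-! ### The locality relation on the tensor square -/

/-- Both components of one pair are orthogonal to both components of the other. -/
def PairOrthogonal (Q : RationalInnerProduct) (p q : LatticeCone × LatticeCone) : Prop :=
  (Orthogonal Q p.1 q.1 ∧ Orthogonal Q p.1 q.2) ∧ Orthogonal Q p.2 q.1 ∧ Orthogonal Q p.2 q.2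

theorem PairOrthogonal.symm {p q : LatticeCone × LatticeCone} (h : PairOrthogonal Q p q) :
    PairOrthogonal Q q p :=
  ⟨⟨h.1.1.symm, h.2.1.symm⟩, h.1.2.symm, h.2.2.symm⟩

/-- Every pair in the support of a tensor occurs in a term of any presentation, which gives one
direction. Conversely, the two basis expansions form an independent presentation; the orthogonality
within each pair holds because the tensors lie in the locality tensor square. -/
theorem tensorRel_iff {x y : localityTensorSquare ℚ (rel Q)} :
    tensorRel ℚ (rel Q) x y ↔ ∀ p ∈ pairSupport (x : ConeSpace ⊗[ℚ] ConeSpace),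
      ∀ q ∈ pairSupport (y : ConeSpace ⊗[ℚ] ConeSpace), PairOrthogonal Q p q := by
  constructor
  · rintro ⟨P⟩ p hp q hq
    rw [P.left_eq] at hp
    rw [P.right_eq] at hq
    obtain ⟨i, ha, hb⟩ := exists_mem_support_of_mem_pairSupport hp
    obtain ⟨j, hc, hd⟩ := exists_mem_support_of_mem_pairSupport hq
    exact ⟨⟨P.rel_ac i j _ ha _ hc, P.rel_ad i j _ ha _ hd⟩,
      P.rel_bc i j _ hb _ hc, P.rel_bd i j _ hb _ hd⟩
  · intro h
    have hs : ∀ {C D : LatticeCone} {r s : ℚ}, Orthogonal Q C D →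
        rel Q (Finsupp.single C r) (Finsupp.single D s) := fun h E hE F hF => by
      rw [Finset.mem_singleton.1 (Finsupp.support_single_subset hE),
        Finset.mem_singleton.1 (Finsupp.support_single_subset hF)]
      exact h
    have hsum : ∀ t : ConeSpace ⊗[ℚ] ConeSpace, t = ∑ i : Fin (pairSupport t).card,
        Finsupp.single ((pairSupport t).equivFin.symm i).1.1
          (finsuppTensorFinsupp' ℚ _ _ t ((pairSupport t).equivFin.symm i)) ⊗ₜ[ℚ]
            of ((pairSupport t).equivFin.symm i).1.2 := fun t => by
      refine (eq_sum_pairSupport t).trans ?_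
      rw [Equiv.sum_comp (pairSupport t).equivFin.symm (fun p : pairSupport t =>
        Finsupp.single p.1.1 (finsuppTensorFinsupp' ℚ _ _ t p.1) ⊗ₜ[ℚ] of p.1.2)]
      exact (Finset.sum_coe_sort (pairSupport t) (fun p => Finsupp.single p.1
        (finsuppTensorFinsupp' ℚ _ _ t p) ⊗ₜ[ℚ] of p.2)).symm
    have hx := mem_localityTensorSquare.1 x.2
    have hy := mem_localityTensorSquare.1 y.2
    exact ⟨{
      m := _
      n := _
      a := _
      b := _
      c := _
      d := _
      left_eq := hsum x
      right_eq := hsum y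
      rel_ab := fun i => hs (hx _ (Subtype.prop _))
      rel_cd := fun j => hs (hy _ (Subtype.prop _))
      rel_ac := fun i j => hs (h _ (Subtype.prop _) _ (Subtype.prop _)).1.1
      rel_ad := fun i j => hs (h _ (Subtype.prop _) _ (Subtype.prop _)).1.2
      rel_bc := fun i j => hs (h _ (Subtype.prop _) _ (Subtype.prop _)).2.1
      rel_bd := fun i j => hs (h _ (Subtype.prop _) _ (Subtype.prop _)).2.2 }⟩

theorem mem_polar_tensorRel {U : Set (localityTensorSquare ℚ (rel Q))}
    {x : localityTensorSquare ℚ (rel Q)} :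
    x ∈ polar (tensorRel ℚ (rel Q)) U ↔ (x : ConeSpace ⊗[ℚ] ConeSpace) ∈ pairSupported
      {q | ∀ u ∈ U, ∀ p ∈ pairSupport (u : ConeSpace ⊗[ℚ] ConeSpace), PairOrthogonal Q p q} := by
  rw [mem_pairSupported]
  constructor
  · exact fun h q hq u hu p hp => tensorRel_iff.1 (h u hu) p hp q hq
  · exact fun h u hu => tensorRel_iff.2 fun p hp q hq => h q hq u hu p hp

/-! ### The factorwise product on the tensor square -/

/-- The factorwise product on `ℚ𝒞 ⊗ ℚ𝒞`, extended by zero to all pairs. -/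
noncomputable def tensorMul (Q : RationalInnerProduct) :
    ConeSpace ⊗[ℚ] ConeSpace →ₗ[ℚ] ConeSpace ⊗[ℚ] ConeSpace →ₗ[ℚ] ConeSpace ⊗[ℚ] ConeSpace :=
  TensorProduct.map₂ (mulBilin Q) (mulBilin Q)

theorem tensorMul_tmul_tmul (a b c d : ConeSpace) :
    tensorMul Q (a ⊗ₜ b) (c ⊗ₜ d) = mulBilin Q a c ⊗ₜ mulBilin Q b d := rfl

theorem tensorMul_of_of {C D E F : LatticeCone} (h : Orthogonal Q C E) (h' : Orthogonal Q D F) :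
    tensorMul Q (of C ⊗ₜ of D) (of E ⊗ₜ of F) = of (C.mul Q E h) ⊗ₜ of (D.mul Q F h') := by
  rw [tensorMul_tmul_tmul, mulBilin_of_of h, mulBilin_of_of h']

theorem tensorMul_mem {x y : ConeSpace ⊗[ℚ] ConeSpace} {P : Set (LatticeCone × LatticeCone)}
    (h : ∀ p ∈ pairSupport x, ∀ q ∈ pairSupport y, PairOrthogonal Q p q)
    (hP : ∀ p ∈ pairSupport x, ∀ q ∈ pairSupport y, ∀ (h : Orthogonal Q p.1 q.1)
      (h' : Orthogonal Q p.2 q.2), (p.1.mul Q q.1 h, p.2.mul Q q.2 h') ∈ P) :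
    tensorMul Q x y ∈ pairSupported P := by
  refine Submodule.bilin_mem_of_mem_span _ ?_ (mem_span_of_tmul_of x) (mem_span_of_tmul_of y)
  rintro _ ⟨p, hp, rfl⟩ _ ⟨q, hq, rfl⟩
  rw [tensorMul_of_of (h p hp q hq).1.1 (h p hp q hq).2.2]
  exact of_tmul_of_mem_pairSupported (hP p hp q hq _ _)

theorem tensorMul_assoc {x y z : ConeSpace ⊗[ℚ] ConeSpace}
    (hxy : ∀ p ∈ pairSupport x, ∀ q ∈ pairSupport y, PairOrthogonal Q p q)
    (hyz : ∀ p ∈ pairSupport y, ∀ q ∈ pairSupport z, PairOrthogonal Q p q)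
    (hxz : ∀ p ∈ pairSupport x, ∀ q ∈ pairSupport z, PairOrthogonal Q p q) :
    tensorMul Q (tensorMul Q x y) z = tensorMul Q x (tensorMul Q y z) := by
  refine Submodule.bilin_assoc_of_mem_span _ ?_ (mem_span_of_tmul_of x) (mem_span_of_tmul_of y)
    (mem_span_of_tmul_of z)
  rintro _ ⟨p, hp, rfl⟩ _ ⟨q, hq, rfl⟩ _ ⟨r, hr, rfl⟩
  have h1 := hxy p hp q hq
  have h2 := hyz q hq r hr
  have h3 := hxz p hp r hr
  rw [tensorMul_of_of h1.1.1 h1.2.2, tensorMul_of_of h2.1.1 h2.2.2,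
    tensorMul_of_of (mul_orthogonal _ h3.1.1 h2.1.1) (mul_orthogonal _ h3.2.2 h2.2.2),
    tensorMul_of_of (orthogonal_mul _ h1.1.1 h3.1.1) (orthogonal_mul _ h1.2.2 h3.2.2),
    LatticeCone.mul_assoc h1.1.1, LatticeCone.mul_assoc h1.2.2]

/-- Orthogonality of `p.1 q.1` and `p.2 q.2` needs four relations: two come from `x` and `y` lying
in the square, the two mixed ones from `x` and `y` being related. -/
theorem tensorMul_mem_square {x y : localityTensorSquare ℚ (rel Q)}
    (h : tensorRel ℚ (rel Q) x y) :
    tensorMul Q x y ∈ localityTensorSquare ℚ (rel Q) := by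
  rw [tensorRel_iff] at h
  refine mem_localityTensorSquare.2 (mem_pairSupported.1 (tensorMul_mem h ?_ :
    _ ∈ pairSupported {p | Orthogonal Q p.1 p.2}))
  intro p hp q hq h1 h2
  have hpq := h p hp q hq
  exact orthogonal_mul h2
    (mul_orthogonal h1 (mem_localityTensorSquare.1 x.2 p hp) hpq.2.1.symm)
    (mul_orthogonal h1 hpq.1.2 (mem_localityTensorSquare.1 y.2 q hq))

/-- The factorwise product on the locality tensor square. -/
noncomputable def squareMul (Q : RationalInnerProduct) (x y : localityTensorSquare ℚ (rel Q))
    (h : tensorRel ℚ (rel Q) x y) : localityTensorSquare ℚ (rel Q) :=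
  ⟨tensorMul Q x y, tensorMul_mem_square h⟩

/-- Independence of the presentation: by bilinearity, every presentation computes the value of
`tensorMul` at `x` and `y`. -/
theorem isTensorSquareMul_squareMul (Q : RationalInnerProduct) :
    IsTensorSquareMul ℚ (rel Q) (mul Q) (squareMul Q) := by
  intro x y h P
  change tensorMul Q x y = _
  simp only [IndependentPresentation.prod, mul_eq_mulBilin, ← tensorMul_tmul_tmul]
  refine (congrArg₂ (fun s t => tensorMul Q s t) P.left_eq P.right_eq).trans ?_
  simp only [map_sum, LinearMap.sum_apply]
  exact Finset.sum_comm

/-- The unit `1 ⊗ 1` of the locality tensor square. -/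
noncomputable def squareOne (Q : RationalInnerProduct) : localityTensorSquare ℚ (rel Q) :=
  ⟨one ⊗ₜ one, of_tmul_of_mem_localityTensor (orthogonal_zero Q _) trivial trivial⟩

theorem tensorMul_one (x : ConeSpace ⊗[ℚ] ConeSpace) : tensorMul Q x (one ⊗ₜ one) = x := by
  induction x using TensorProduct.induction_on with
  | zero => simp
  | tmul a b => rw [tensorMul_tmul_tmul, mulBilin_one, mulBilin_one]
  | add a b ha hb => rw [map_add, LinearMap.add_apply, ha, hb]

theorem one_tensorMul (x : ConeSpace ⊗[ℚ] ConeSpace) : tensorMul Q (one ⊗ₜ one) x = x := by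
  induction x using TensorProduct.induction_on with
  | zero => simp
  | tmul a b => rw [tensorMul_tmul_tmul, one_mulBilin, one_mulBilin]
  | add a b ha hb => rw [map_add, ha, hb]

theorem isLocalityAlgebra_square (Q : RationalInnerProduct) :
    IsLocalityAlgebra ℚ (tensorRel ℚ (rel Q)) (squareMul Q) (squareOne Q) where
  symm x y h := tensorRel_iff.2 fun p hp q hq => (tensorRel_iff.1 h q hq p hp).symm
  polar_subspace U := ⟨(pairSupported _).comap (Submodule.subtype _),
    Set.ext fun _ => mem_polar_tensorRel.symm⟩
  add_mul x x' y _ _ _ := Subtype.ext (by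
    simp only [squareMul, Submodule.coe_add, map_add, LinearMap.add_apply])
  mul_add x y y' _ _ _ := Subtype.ext (by
    simp only [squareMul, Submodule.coe_add, map_add])
  smul_mul k x y _ _ := Subtype.ext (by
    simp only [squareMul, Submodule.coe_smul, map_smul, LinearMap.smul_apply])
  mul_smul k x y _ _ := Subtype.ext (by
    simp only [squareMul, Submodule.coe_smul, map_smul])
  mul_mem_polar U x y h hx hy := by
    rw [mem_polar_tensorRel] at hx hy ⊢
    rw [mem_pairSupported] at hx hy
    refine tensorMul_mem (tensorRel_iff.1 h) fun p hp q hq k k' u hu r hr => ?_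
    have h1 := hx p hp u hu r hr
    have h2 := hy q hq u hu r hr
    exact ⟨⟨orthogonal_mul k h1.1.1 h2.1.1, orthogonal_mul k' h1.1.2 h2.1.2⟩,
      orthogonal_mul k h1.2.1 h2.2.1, orthogonal_mul k' h1.2.2 h2.2.2⟩
  mul_assoc x y z hxy hyz hxz _ _ := Subtype.ext
    (tensorMul_assoc (tensorRel_iff.1 hxy) (tensorRel_iff.1 hyz) (tensorRel_iff.1 hxz))
  polar_one := by
    refine Set.eq_univ_of_forall fun x => ?_
    rintro _ rfl
    have h1 : (squareOne Q : ConeSpace ⊗[ℚ] ConeSpace) ∈ pairSupported {(zero, zero)} :=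
      of_tmul_of_mem_pairSupported rfl
    refine tensorRel_iff.2 fun p hp q hq => ?_
    rw [Set.mem_singleton_iff.1 (mem_pairSupported.1 h1 p hp)]
    exact ⟨⟨zero_orthogonal Q _, zero_orthogonal Q _⟩, zero_orthogonal Q _, zero_orthogonal Q _⟩
  mul_one x _ := Subtype.ext (tensorMul_one (x : ConeSpace ⊗[ℚ] ConeSpace))
  one_mul x _ := Subtype.ext (one_tensorMul (x : ConeSpace ⊗[ℚ] ConeSpace))

/-! ### The coproduct and the counit -/

theorem comul_of (C : LatticeCone) : comul Q (of C) =
    ∑ F : C.Face, of (C.transverse Q F) ⊗ₜ[ℚ] of (C.face F) := by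
  rw [comul, of, Finsupp.linearCombination_single, one_smul]

theorem counit_apply (x : ConeSpace) : counit x = x LatticeCone.zero := by
  classical
  have h : counit = Finsupp.lapply LatticeCone.zero :=
    Finsupp.lhom_ext' fun C => LinearMap.ext_ring (by
      simp [counit, Finsupp.single_apply])
  rw [h, Finsupp.lapply_apply]

theorem counit_of [DecidableEq LatticeCone] (C : LatticeCone) :
    counit (of C) = if C = LatticeCone.zero then 1 else 0 := by
  rw [counit_apply, Finsupp.single_apply]

theorem comul_mem {x : ConeSpace} {R : Submodule ℚ (ConeSpace ⊗[ℚ] ConeSpace)}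
    (h : ∀ C ∈ x.support, ∀ F : C.Face, of (C.transverse Q F) ⊗ₜ[ℚ] of (C.face F) ∈ R) :
    comul Q x ∈ R := by
  rw [comul, Finsupp.linearCombination_apply]
  exact Submodule.sum_mem _ fun C hC =>
    Submodule.smul_mem _ _ (Submodule.sum_mem _ fun F _ => h C hC F)

theorem of_mem_polar_of_lin_le {U : Set ConeSpace} {x : ConeSpace} (hx : x ∈ polar (rel Q) U)
    {C D : LatticeCone} (hC : C ∈ x.support) (h : D.lin ≤ C.lin) : of D ∈ polar (rel Q) U :=
  of_mem_polar.2 fun u hu E hE => (hx u hu E hE C hC).mono le_rfl h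

/-- Both sides become sums over flags `G ≤ F` of faces of `C`, taken in opposite orders. -/
theorem sum_face_transverse_eq_sum_face_face {A : Type*} [AddCommMonoid A] (C : LatticeCone)
    (f : LatticeCone → LatticeCone → LatticeCone → A) :
    ∑ G : C.Face, ∑ H : (C.transverse Q G).Face,
      f ((C.transverse Q G).transverse Q H) ((C.transverse Q G).face H) (C.face G) =
    ∑ F : C.Face, ∑ G : (C.face F).Face,
      f (C.transverse Q F) ((C.face F).transverse Q G) ((C.face F).face G) := by
  classical
  have h1 : ∀ G : C.Face, ∑ H : (C.transverse Q G).Face,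
      f ((C.transverse Q G).transverse Q H) ((C.transverse Q G).face H) (C.face G) =
      ∑ F : {F : C.Face // G.1 ≤ F.1}, f (C.transverse Q F.1)
        ((C.face F.1).transverse Q ((faceFaceEquiv F.1).symm ⟨G, F.2⟩)) (C.face G) := by
    intro G
    rw [← Equiv.sum_comp (faceTransverseEquiv Q G).symm]
    refine Finset.sum_congr rfl fun F _ => ?_
    rw [transverse_transverse F.1 G F.2, face_transverse F.1 G F.2]
  have h2 : ∀ F : C.Face, ∑ G : (C.face F).Face,
      f (C.transverse Q F) ((C.face F).transverse Q G) ((C.face F).face G) =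
      ∑ G : {G : C.Face // G.1 ≤ F.1}, f (C.transverse Q F)
        ((C.face F).transverse Q ((faceFaceEquiv F).symm G)) (C.face G.1) := by
    intro F
    rw [← Equiv.sum_comp (faceFaceEquiv F).symm]
    refine Finset.sum_congr rfl fun G _ => ?_
    rw [face_face F G]
  rw [Finset.sum_congr rfl fun G _ => h1 G, Finset.sum_congr rfl fun F _ => h2 F,
    Finset.sum_sigma', Finset.sum_sigma']
  exact Finset.sum_bij' (fun P _ => ⟨P.2.1, P.1, P.2.2⟩) (fun P _ => ⟨P.2.1, P.1, P.2.2⟩)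
    (fun _ _ => Finset.mem_univ _) (fun _ _ => Finset.mem_univ _) (fun _ _ => rfl)
    (fun _ _ => rfl) (fun _ _ => rfl)

theorem comul_coassoc (Q : RationalInnerProduct) :
    TensorProduct.assoc ℚ ConeSpace ConeSpace ConeSpace ∘ₗ (comul Q).rTensor ConeSpace ∘ₗ comul Q =
      (comul Q).lTensor ConeSpace ∘ₗ comul Q := by
  refine Finsupp.lhom_ext' fun C => LinearMap.ext_ring ?_
  change TensorProduct.assoc ℚ ConeSpace ConeSpace ConeSpace
    ((comul Q).rTensor ConeSpace (comul Q (of C))) = (comul Q).lTensor ConeSpace (comul Q (of C))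
  simp only [comul_of, map_sum, LinearMap.rTensor_tmul, LinearMap.lTensor_tmul,
    TensorProduct.sum_tmul, TensorProduct.tmul_sum, TensorProduct.assoc_tmul]
  exact sum_face_transverse_eq_sum_face_face C fun A B D => of A ⊗ₜ[ℚ] (of B ⊗ₜ[ℚ] of D)

theorem rTensor_counit_comul (x : ConeSpace) :
    TensorProduct.lid ℚ ConeSpace (counit.rTensor ConeSpace (comul Q x)) = x := by
  classical
  have h : (TensorProduct.lid ℚ ConeSpace).toLinearMap ∘ₗ counit.rTensor ConeSpace ∘ₗ comul Q =
      LinearMap.id := by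
    refine Finsupp.lhom_ext' fun C => LinearMap.ext_ring ?_
    change TensorProduct.lid ℚ ConeSpace (counit.rTensor ConeSpace (comul Q (of C))) = of C
    simp only [comul_of, map_sum, LinearMap.rTensor_tmul, TensorProduct.lid_tmul, counit_of,
      transverse_eq_zero_iff, ite_smul, one_smul, zero_smul]
    -- Only the face `C` has a trivial transverse cone, and its term is `1 ⊗ C`.
    rw [Finset.sum_ite_eq' Finset.univ C.topFace, if_pos (Finset.mem_univ _), face_topFace]
  exact LinearMap.congr_fun h x

theorem lTensor_counit_comul (x : ConeSpace) :
    TensorProduct.rid ℚ ConeSpace (counit.lTensor ConeSpace (comul Q x)) = x := by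
  classical
  have h : (TensorProduct.rid ℚ ConeSpace).toLinearMap ∘ₗ counit.lTensor ConeSpace ∘ₗ comul Q =
      LinearMap.id := by
    refine Finsupp.lhom_ext' fun C => LinearMap.ext_ring ?_
    change TensorProduct.rid ℚ ConeSpace (counit.lTensor ConeSpace (comul Q (of C))) = of C
    simp only [comul_of, map_sum, LinearMap.lTensor_tmul, TensorProduct.rid_tmul, counit_of,
      face_eq_zero_iff, ite_smul, one_smul, zero_smul]
    rw [Finset.sum_ite_eq' Finset.univ C.botFace, if_pos (Finset.mem_univ _), transverse_botFace]
  exact LinearMap.congr_fun h x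

theorem isLocalityCoalgebra (Q : RationalInnerProduct) :
    IsLocalityCoalgebra ℚ (rel Q) (comul Q) counit where
  toIsLocalityVectorSpace := isLocalityVectorSpace Q
  comul_mem _ _ hx := comul_mem fun _ hC F =>
    of_tmul_of_mem_localityTensor (transverse_orthogonal_face F)
      (of_mem_polar_of_lin_le hx hC (transverse_lin_le F))
      (of_mem_polar_of_lin_le hx hC (face_lin_le F))
  coassoc := comul_coassoc Q
  rTensor_counit := rTensor_counit_comul
  lTensor_counit := lTensor_counit_comul

/-! ### Compatibility of products and coproducts -/

theorem comul_mem_square (x : ConeSpace) : comul Q x ∈ localityTensorSquare ℚ (rel Q) :=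
  comul_mem fun _ _ F =>
    of_tmul_of_mem_localityTensor (transverse_orthogonal_face F) trivial trivial

/-- With `Orthogonal.mono`, this makes the coproduct preserve the locality relation. -/
theorem exists_lin_le_of_mem_pairSupport_comul {x : ConeSpace} {p : LatticeCone × LatticeCone}
    (hp : p ∈ pairSupport (comul Q x)) :
    ∃ C ∈ x.support, p.1.lin ≤ C.lin ∧ p.2.lin ≤ C.lin :=
  mem_pairSupported.1 (comul_mem fun C hC F => of_tmul_of_mem_pairSupported
    (P := {p | ∃ C ∈ x.support, p.1.lin ≤ C.lin ∧ p.2.lin ≤ C.lin})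
    ⟨C, hC, transverse_lin_le F, face_lin_le F⟩) p hp

/-- Reindexing the faces of `C + D` by pairs of faces turns the left side into the product of the
two sums, term by term. -/
theorem comul_of_mul {C D : LatticeCone} (h : Orthogonal Q C D) :
    comul Q (of (C.mul Q D h)) = tensorMul Q (comul Q (of C)) (comul Q (of D)) := by
  simp only [comul_of, map_sum, LinearMap.sum_apply]
  rw [← Equiv.sum_comp (faceMulEquiv h), Fintype.sum_prod_type, Finset.sum_comm]
  refine Finset.sum_congr rfl fun G _ => Finset.sum_congr rfl fun F _ => ?_
  have h1 : Orthogonal Q (C.transverse Q F) (D.transverse Q G) :=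
    h.mono (transverse_lin_le F) (transverse_lin_le G)
  have h2 : Orthogonal Q (C.face F) (D.face G) := h.mono (face_lin_le F) (face_lin_le G)
  rw [transverse_faceMulEquiv h F G h1, face_faceMulEquiv h F G h2, tensorMul_of_of h1 h2]

theorem comul_mulBilin {x y : ConeSpace} (h : rel Q x y) :
    comul Q (mulBilin Q x y) = tensorMul Q (comul Q x) (comul Q y) := by
  have key := Submodule.bilin_eq_of_mem_span ((mulBilin Q).compr₂ (comul Q))
    ((tensorMul Q).compl₁₂ (comul Q) (comul Q)) ?_ (mem_span_of x) (mem_span_of y)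
  · rwa [LinearMap.compr₂_apply, LinearMap.compl₁₂_apply] at key
  rintro _ ⟨C, hC, rfl⟩ _ ⟨D, hD, rfl⟩
  rw [LinearMap.compr₂_apply, LinearMap.compl₁₂_apply, mulBilin_of_of (h C hC D hD), comul_of_mul]

theorem counit_mulBilin {x y : ConeSpace} (h : rel Q x y) :
    counit (mulBilin Q x y) = counit x * counit y := by
  classical
  refine Submodule.bilin_eq_of_mem_span ((mulBilin Q).compr₂ counit)
    ((LinearMap.mul ℚ ℚ).compl₁₂ counit counit) ?_ (mem_span_of x) (mem_span_of y)
  rintro _ ⟨C, hC, rfl⟩ _ ⟨D, hD, rfl⟩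
  change counit (mulBilin Q (of C) (of D)) = counit (of C) * counit (of D)
  rw [mulBilin_of_of (h C hC D hD)]
  simp only [counit_of, mul_eq_zero_iff, ite_and, mul_ite, mul_one, MulZeroClass.mul_zero]
  split_ifs <;> rfl

theorem comul_one (Q : RationalInnerProduct) : comul Q one = one ⊗ₜ[ℚ] one := by
  have hu : ∀ F : LatticeCone.zero.Face, F = LatticeCone.zero.botFace := fun F =>
    Subtype.ext (eq_bot_iff.2 F.2.le)
  have : Unique LatticeCone.zero.Face := ⟨⟨LatticeCone.zero.botFace⟩, hu⟩
  change comul Q (of _) = _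
  rw [comul_of, Fintype.sum_unique, hu default, transverse_botFace, face_botFace]
  rfl

theorem isLocalityAlgebraHom_comul (Q : RationalInnerProduct) :
    IsLocalityAlgebraHom (rel Q) (mul Q) one (tensorRel ℚ (rel Q)) (squareMul Q) (squareOne Q)
      ((comul Q).codRestrict (localityTensorSquare ℚ (rel Q)) comul_mem_square) where
  map_rel x y h := tensorRel_iff.2 fun p hp q hq => by
    obtain ⟨C, hC, h1, h2⟩ := exists_lin_le_of_mem_pairSupport_comul hp
    obtain ⟨D, hD, h3, h4⟩ := exists_lin_le_of_mem_pairSupport_comul hq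
    have := h C hC D hD
    exact ⟨⟨this.mono h1 h3, this.mono h1 h4⟩, this.mono h2 h3, this.mono h2 h4⟩
  map_mul x y h _ := Subtype.ext (by
    rw [mul_eq_mulBilin]
    exact comul_mulBilin h)
  map_one := Subtype.ext (comul_one Q)

theorem isLocalityBialgebra (Q : RationalInnerProduct) :
    IsLocalityBialgebra ℚ (rel Q) (mul Q) one (comul Q) counit where
  algebra := isLocalityAlgebra Q
  coalgebra := isLocalityCoalgebra Q
  comul_hom := ⟨squareMul Q, squareOne Q, comul_mem_square, isTensorSquareMul_squareMul Q, rfl,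
    isLocalityAlgebra_square Q, isLocalityAlgebraHom_comul Q⟩
  counit_hom :=
    { map_rel := fun _ _ _ => trivial
      map_mul := fun x y h _ => by rw [mul_eq_mulBilin, counit_mulBilin h]
      map_one := by rw [counit_apply, one, Finsupp.single_eq_same] }

/-! ### The grading -/

theorem of_mem_grading (C : LatticeCone) : of C ∈ grading C.dim := of_mem_supported rfl

theorem dim_eq_of_mem_grading {n : ℕ} {x : ConeSpace} (hx : x ∈ grading n) {C : LatticeCone}
    (hC : C ∈ x.support) : C.dim = n := hx hC

theorem isInternal_grading : DirectSum.IsInternal grading := by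
  refine DirectSum.isInternal_submodule_of_iSupIndep_of_iSup_eq_top ?_ ?_
  · refine iSupIndep_def.2 fun n => ?_
    have h : ⨆ (m) (_ : m ≠ n), grading m =
        Finsupp.supported ℚ ℚ (⋃ m : {m // m ≠ n}, {C : LatticeCone | C.dim = m}) :=
      iSup_subtype'.trans (Finsupp.supported_iUnion _).symm
    rw [h]
    refine Finsupp.disjoint_supported_supported (Set.disjoint_left.2 fun C hC hC' => ?_)
    obtain ⟨m, hm⟩ := Set.mem_iUnion.1 hC'
    exact m.2 (Eq.trans (Eq.symm hm) hC)
  · have h : ⨆ m, grading m = Finsupp.supported ℚ ℚ (⋃ m, {C : LatticeCone | C.dim = m}) :=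
      (Finsupp.supported_iUnion _).symm
    rw [h, ← Finsupp.supported_univ]
    congr 1
    exact Set.eq_univ_of_forall fun C => Set.mem_iUnion.2 ⟨C.dim, rfl⟩

/-- The counit reads off the coefficient of `({0}, {0})`, the only lattice cone of dimension zero.
-/
theorem iSup_grading_succ : ⨆ n : ℕ, grading (n + 1) = LinearMap.ker counit := by
  have h : ⨆ n, grading (n + 1) =
      Finsupp.supported ℚ ℚ (⋃ n : ℕ, {C : LatticeCone | C.dim = n + 1}) :=
    (Finsupp.supported_iUnion _).symm
  ext x
  rw [h, LinearMap.mem_ker, counit_apply, Finsupp.mem_supported]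
  constructor
  · intro h
    by_contra h0
    obtain ⟨n, hn⟩ := Set.mem_iUnion.1 (h (Finsupp.mem_support_iff.2 h0))
    exact absurd ((dim_eq_zero_iff.2 rfl).symm.trans hn) n.succ_ne_zero.symm
  · intro h C hC
    have hC0 : C.dim ≠ 0 := by
      rintro h0
      rw [dim_eq_zero_iff.1 h0] at hC
      exact Finsupp.mem_support_iff.1 hC h
    exact Set.mem_iUnion.2 ⟨C.dim - 1, (Nat.succ_pred_eq_of_ne_zero hC0).symm⟩

end ConeSpace

open ConeSpace LatticeCone in
theorem proposition5p2 (Q : RationalInnerProduct) :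
    IsConnectedLocalityBialgebra ℚ (ConeSpace.rel Q) (ConeSpace.mul Q) ConeSpace.one
      (ConeSpace.comul Q) ConeSpace.counit ConeSpace.grading where
  toIsLocalityBialgebra := isLocalityBialgebra Q
  isInternal := isInternal_grading
  mul_mem_graded m n x y h hx hy := by
    rw [mul_eq_mulBilin]
    exact mulBilin_mem h fun C hC D hD hCD => of_mem_supported (by
      rw [Set.mem_ofPred_eq, mul_dim, dim_eq_of_mem_grading hx hC, dim_eq_of_mem_grading hy hD])
  comul_mem_graded U n x hx hU := comul_mem fun C hC F => by
    have hn : ((C.transverse Q F).dim, (C.face F).dim) ∈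
        Finset.HasAntidiagonal.antidiagonal n := by
      rw [Finset.HasAntidiagonal.mem_antidiagonal, transverse_dim_add_face_dim,
        dim_eq_of_mem_grading hx hC]
    exact Submodule.mem_iSup_of_mem _ (Submodule.mem_iSup_of_mem hn
      (of_tmul_of_mem_localityTensor (transverse_orthogonal_face F)
        ⟨of_mem_grading _, of_mem_polar_of_lin_le hU hC (transverse_lin_le F)⟩
        ⟨of_mem_grading _, of_mem_polar_of_lin_le hU hC (face_lin_le F)⟩))
  ker_counit := iSup_grading_succ
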